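/- Let $n\ge 3$, let $S^n\subset\mathbb{R}^{n+1}$ be the unit sphere and let $g_0$ be the round metric on it. For a smooth Riemannian metric $g$ on $S^n$ with Laplace--Beltrami operator $\Delta_g$, scalar curvature $R_g$ and volume measure $dV_g$, let $\lambda_0(g)$ denote the lowest eigenvalue of the conformal Laplacian $$\Box_g=-\Delta_g+\frac{n-2}{4(n-1)}R_g .$$ Every metric in the conformal class $[g_0]$ is written $\widetilde g=\mu^{4/(n-2)}g_0$ with a unique positive function $\mu\in C^\infty(S^n)$; put $$\bar\lambda_0(S^n,g_0,\widetilde g)=\lambda_0(\widetilde g)\int_{S^n}\mu^{4/(n-2)}\,dV_{g_0},\qquad \Lambda_0(S^n,g_0)=\sup_{\widetilde g\in[g_0]}\bar\lambda_0(S^n,g_0,\widetilde g).$$ Then this supremum is finite and is attained at the round metric: $$\Lambda_0(S^n,g_0)=\bar\lambda_0(S^n,g_0,g_0).$$ Moreover, if $\widetilde g\in[g_0]$ satisfies $\Lambda_0(S^n,g_0)=\bar\lambda_0(S^n,g_0,\widetilde g)$, then $\widetilde g=c\,g_0$ for some constant $c>0$. -/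

import Mathlib

open Metric Module MeasureTheory Bundle Set
open scoped Manifold ContDiff InnerProductSpace

noncomputable section

namespace ConformalSphere

/-! ### Calculus in a coordinate system of `ℝⁿ` -/

section Coordinates

variable {n : ℕ}

/-- The `i`-th partial derivative. -/
def partialD (i : Fin n) (f : EuclideanSpace ℝ (Fin n) → ℝ) (y : EuclideanSpace ℝ (Fin n)) : ℝ :=
  fderiv ℝ f y (EuclideanSpace.single i 1)

/-- The Christoffel symbol `Γᵏᵢⱼ = ½ gᵏˡ (∂ᵢ gⱼₗ + ∂ⱼ gᵢₗ - ∂ₗ gᵢⱼ)` of a matrix field `G = (gᵢⱼ)`. -/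
def christoffel (G : EuclideanSpace ℝ (Fin n) → Matrix (Fin n) (Fin n) ℝ) (k i j : Fin n)
    (y : EuclideanSpace ℝ (Fin n)) : ℝ :=
  (1 / 2 : ℝ) * ∑ l, (G y)⁻¹ k l *
    (partialD i (fun z => G z j l) y + partialD j (fun z => G z i l) y
      - partialD l (fun z => G z i j) y)

/-- The Ricci tensor
`Ricᵢⱼ = ∂ₖ Γᵏᵢⱼ - ∂ⱼ Γᵏᵢₖ + Γᵏₖₗ Γˡᵢⱼ - Γᵏⱼₗ Γˡᵢₖ` (summed over repeated indices). -/
def ricciCoord (G : EuclideanSpace ℝ (Fin n) → Matrix (Fin n) (Fin n) ℝ) (i j : Fin n)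
    (y : EuclideanSpace ℝ (Fin n)) : ℝ :=
  ∑ k, (partialD k (christoffel G k i j) y - partialD j (christoffel G k i k) y)
    + ∑ k, ∑ l, (christoffel G k k l y * christoffel G l i j y
      - christoffel G k j l y * christoffel G l i k y)

/-- The scalar curvature `gⁱʲ Ricᵢⱼ` (it is `n (n - 1)` for the unit `n`-sphere). -/
def scalarCoord (G : EuclideanSpace ℝ (Fin n) → Matrix (Fin n) (Fin n) ℝ)
    (y : EuclideanSpace ℝ (Fin n)) : ℝ :=
  ∑ i, ∑ j, (G y)⁻¹ i j * ricciCoord G i j y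

/-- The Laplace-Beltrami operator `gⁱʲ (∂ᵢ ∂ⱼ f - Γᵏᵢⱼ ∂ₖ f)`. -/
def laplaceCoord (G : EuclideanSpace ℝ (Fin n) → Matrix (Fin n) (Fin n) ℝ)
    (f : EuclideanSpace ℝ (Fin n) → ℝ) (y : EuclideanSpace ℝ (Fin n)) : ℝ :=
  ∑ i, ∑ j, (G y)⁻¹ i j *
    (partialD i (partialD j f) y - ∑ k, christoffel G k i j y * partialD k f y)

end Coordinates

/-! ### Riemannian metrics on a smooth manifold -/

section Manifold

variable {n : ℕ} {M : Type*} [TopologicalSpace M] [ChartedSpace (EuclideanSpace ℝ (Fin n)) M]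
  [IsManifold (𝓡 n) ∞ M]

variable (n M) in
/-- Smooth Riemannian metrics on the `n`-manifold `M`. -/
abbrev SmoothMetric : Type _ :=
  ContMDiffRiemannianMetric (𝓡 n) ∞ (EuclideanSpace ℝ (Fin n))
    (fun x : M => TangentSpace (𝓡 n) x)

variable (n M) in
/-- Smooth real functions on the `n`-manifold `M`. -/
abbrev SmoothFun : Type _ := ContMDiffMap (𝓡 n) 𝓘(ℝ, ℝ) M ℝ ∞

/-- The components `g(∂ᵢ, ∂ⱼ)` of `g` in the chart at `x`, as functions of the coordinates. -/
def metricCoord (g : SmoothMetric n M) (x : M) (y : EuclideanSpace ℝ (Fin n)) :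
    Matrix (Fin n) (Fin n) ℝ :=
  Matrix.of fun i j =>
    g.inner ((chartAt (EuclideanSpace ℝ (Fin n)) x).symm y)
      (mfderiv (𝓡 n) (𝓡 n) (chartAt (EuclideanSpace ℝ (Fin n)) x).symm y
        (EuclideanSpace.single i (1 : ℝ)))
      (mfderiv (𝓡 n) (𝓡 n) (chartAt (EuclideanSpace ℝ (Fin n)) x).symm y
        (EuclideanSpace.single j (1 : ℝ)))

/-- The scalar curvature `R_g`, computed at each point in the chart at that point. -/
def scalarCurvature (g : SmoothMetric n M) (x : M) : ℝ :=
  scalarCoord (metricCoord g x) (chartAt (EuclideanSpace ℝ (Fin n)) x x)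

/-- The Laplace-Beltrami operator `Δ_g`, computed at each point in the chart at that point
(the sign is such that `Δ_g = ∑ ∂ᵢ²` for the flat metric). -/
def laplaceBeltrami (g : SmoothMetric n M) (u : SmoothFun n M) (x : M) : ℝ :=
  laplaceCoord (metricCoord g x)
    (fun y => u ((chartAt (EuclideanSpace ℝ (Fin n)) x).symm y))
    (chartAt (EuclideanSpace ℝ (Fin n)) x x)

/-- The conformal Laplacian `-Δ_g + cₙ R_g` with `cₙ = (n - 2) / (4 (n - 1))`. -/
def conformalLaplacian (g : SmoothMetric n M) (u : SmoothFun n M) (x : M) : ℝ :=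
  -laplaceBeltrami g u x
    + ((n : ℝ) - 2) / (4 * ((n : ℝ) - 1)) * scalarCurvature g x * u x

variable (n M) in
/-- Positive smooth functions. -/
abbrev PosFun : Type _ := {μ : SmoothFun n M // ∀ x, 0 < μ x}

/-- The constant function `1`. -/
instance : One (PosFun n M) := ⟨⟨1, fun _ => one_pos⟩⟩

/-- The conformal metric `μ ^ (4 / (n - 2)) g`. -/
def conformalMetric (g : SmoothMetric n M) (μ : PosFun n M) : SmoothMetric n M where
  inner x := (μ.1 x ^ (4 / ((n : ℝ) - 2)) : ℝ) • g.inner x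
  symm x v w := by
    change _ * g.inner x v w = _ * g.inner x w v
    rw [g.symm]
  pos x v hv := mul_pos (Real.rpow_pos_of_pos (μ.2 x) _) (g.pos x v hv)
  isVonNBounded x := by
    set c : ℝ := μ.1 x ^ (4 / ((n : ℝ) - 2)) with hc
    have hc0 : 0 < c := Real.rpow_pos_of_pos (μ.2 x) _
    have hs : √c ≠ 0 := (Real.sqrt_pos.2 hc0).ne'
    refine ((g.isVonNBounded x).image
      ((√c)⁻¹ • ContinuousLinearMap.id ℝ (TangentSpace (𝓡 n) x))).subset ?_
    intro v hv
    refine ⟨√c • v, ?_, by simp [smul_smul, hs]⟩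
    have h : c * g.inner x v v < 1 := hv
    change g.inner x (√c • v) (√c • v) < 1
    have h2 : g.inner x (√c • v) (√c • v) = √c * (√c * g.inner x v v) := by simp
    rw [h2, ← mul_assoc, Real.mul_self_sqrt hc0.le]
    exact h
  contMDiff := by
    have hf : ContMDiff (𝓡 n) 𝓘(ℝ, ℝ) ∞ (fun x => (μ.1 x ^ (4 / ((n : ℝ) - 2)) : ℝ)) := by
      intro x
      have h1 : ContDiffAt ℝ ∞ (fun t : ℝ => t ^ (4 / ((n : ℝ) - 2))) (μ.1 x) :=
        Real.contDiffAt_rpow_const_of_ne (μ.2 x).ne'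
      exact h1.contMDiffAt.comp x (μ.1.contMDiff x)
    intro x
    have hg := g.contMDiff x
    rw [contMDiffAt_hom_bundle] at hg ⊢
    refine ⟨hg.1, ((hf x).smul hg.2).congr_of_eventuallyEq (Filter.Eventually.of_forall ?_)⟩
    intro z
    ext v w
    simp [ContinuousLinearMap.inCoordinates]

@[simp] theorem conformalMetric_one (g : SmoothMetric n M) : conformalMetric g 1 = g := by
  have h : (conformalMetric g 1).inner = g.inner := by
    funext x
    change ((1 : ℝ) ^ (4 / ((n : ℝ) - 2)) : ℝ) • g.inner x = g.inner x
    simp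
  cases g
  simp only [conformalMetric] at h ⊢
  congr

end Manifold

/-! ### The sphere -/

/-- The unit sphere `Sⁿ` of `ℝⁿ⁺¹`. -/
abbrev Sph (n : ℕ) : Type := sphere (0 : EuclideanSpace ℝ (Fin (n + 1))) 1

/-- The differential at `x` of the inclusion of `Sⁿ` in `ℝⁿ⁺¹`. -/
def inclDeriv (n : ℕ) (x : Sph n) :
    TangentSpace (𝓡 n) x →L[ℝ] EuclideanSpace ℝ (Fin (n + 1)) :=
  mfderiv (𝓡 n) 𝓘(ℝ, EuclideanSpace ℝ (Fin (n + 1)))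
    ((↑) : Sph n → EuclideanSpace ℝ (Fin (n + 1))) x

theorem inclDeriv_injective (n : ℕ) (x : Sph n) : Function.Injective (inclDeriv n x) :=
  haveI := Fact.mk (@finrank_euclideanSpace_fin ℝ _ (n + 1))
  injective_mvfderiv_subtypeVal_sphere x

/-- The bilinear form `(v, w) ↦ ⟪A v, A w⟫`. -/
def pullbackInner {n m : ℕ} (A : EuclideanSpace ℝ (Fin n) →L[ℝ] EuclideanSpace ℝ (Fin m)) :
    EuclideanSpace ℝ (Fin n) →L[ℝ] EuclideanSpace ℝ (Fin n) →L[ℝ] ℝ :=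
  ContinuousLinearMap.bilinearComp
    (innerSL ℝ : EuclideanSpace ℝ (Fin m) →L[ℝ] EuclideanSpace ℝ (Fin m) →L[ℝ] ℝ) A A

theorem isVonNBounded_pullbackInner {n m : ℕ}
    (A : EuclideanSpace ℝ (Fin n) →L[ℝ] EuclideanSpace ℝ (Fin m)) (hA : Function.Injective A) :
    Bornology.IsVonNBounded ℝ {v | pullbackInner A v v < 1} := by
  have hker : A.toLinearMap.ker = ⊥ := LinearMap.ker_eq_bot.2 hA
  obtain ⟨K, -, hK⟩ := A.toLinearMap.exists_antilipschitzWith hker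
  rw [NormedSpace.isVonNBounded_iff]
  refine (hK.isBounded_preimage (Metric.isBounded_ball (x := 0) (r := 1))).subset ?_
  intro v hv
  have h : ⟪A v, A v⟫_ℝ < 1 := hv
  rw [real_inner_self_eq_norm_sq] at h
  simp only [mem_preimage, mem_ball_zero_iff]
  exact (sq_lt_one_iff₀ (norm_nonneg _)).1 h

theorem contDiff_pullbackInner {n m : ℕ} :
    ContDiff ℝ ∞ (fun A : EuclideanSpace ℝ (Fin n) →L[ℝ] EuclideanSpace ℝ (Fin m) =>
      pullbackInner A) := by
  have h : ContDiff ℝ ∞ (fun A : EuclideanSpace ℝ (Fin n) →L[ℝ] EuclideanSpace ℝ (Fin m) =>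
      ((ContinuousLinearMap.compL ℝ (EuclideanSpace ℝ (Fin n)) (EuclideanSpace ℝ (Fin m)) ℝ).flip
        A).comp ((innerSL ℝ : EuclideanSpace ℝ (Fin m) →L[ℝ]
          EuclideanSpace ℝ (Fin m) →L[ℝ] ℝ).comp A)) :=
    (ContinuousLinearMap.contDiff _).clm_comp (contDiff_const.clm_comp contDiff_id)
  exact h

/-- The standard round metric `g₀` of `Sⁿ`, induced from the Euclidean inner product. -/
def roundMetric (n : ℕ) : SmoothMetric n (Sph n) where
  inner x := pullbackInner (inclDeriv n x)
  symm x v w := by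
    change ⟪inclDeriv n x v, inclDeriv n x w⟫_ℝ = ⟪inclDeriv n x w, inclDeriv n x v⟫_ℝ
    rw [real_inner_comm]
  pos x v hv := by
    change 0 < ⟪inclDeriv n x v, inclDeriv n x v⟫_ℝ
    exact real_inner_self_pos.2 fun h => hv (inclDeriv_injective n x (by simpa using h))
  isVonNBounded x := isVonNBounded_pullbackInner _ (inclDeriv_injective n x)
  contMDiff := by
    have := Fact.mk (@finrank_euclideanSpace_fin ℝ _ (n + 1))
    intro x
    have hD : ContMDiffAt (𝓡 n) 𝓘(ℝ, EuclideanSpace ℝ (Fin n) →L[ℝ]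
        EuclideanSpace ℝ (Fin (n + 1))) ∞ (inTangentCoordinates (𝓡 n)
          𝓘(ℝ, EuclideanSpace ℝ (Fin (n + 1))) id
          ((↑) : Sph n → EuclideanSpace ℝ (Fin (n + 1))) (inclDeriv n) x) x :=
      ContMDiffAt.mfderiv_const (n := ∞)
        (f := ((↑) : Sph n → EuclideanSpace ℝ (Fin (n + 1)))) (contMDiff_coe_sphere x) le_rfl
    set D := (inTangentCoordinates (𝓡 n)
          𝓘(ℝ, EuclideanSpace ℝ (Fin (n + 1))) id
          ((↑) : Sph n → EuclideanSpace ℝ (Fin (n + 1))) (inclDeriv n) x) with hDdef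
    rw [contMDiffAt_hom_bundle]
    refine ⟨contMDiffAt_id, ?_⟩
    have h2 : ContMDiffAt (𝓡 n) 𝓘(ℝ, EuclideanSpace ℝ (Fin n) →L[ℝ]
        EuclideanSpace ℝ (Fin n) →L[ℝ] ℝ) ∞ (fun z => pullbackInner (D z)) x := by
      exact ((contDiff_pullbackInner (n := n) (m := n + 1)).contMDiff (D x)).comp x hD
    refine h2.congr_of_eventuallyEq ?_
    filter_upwards [(trivializationAt (EuclideanSpace ℝ (Fin n))
      (fun x : Sph n => TangentSpace (𝓡 n) x) x).open_baseSet.mem_nhds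
        (FiberBundle.mem_baseSet_trivializationAt' x)] with z hz
    ext v w
    have hz' : z ∈ (chartAt (EuclideanSpace ℝ (Fin n)) x).source := by simpa using hz
    have e1 : ∀ v, D z v = inclDeriv n z ((trivializationAt (EuclideanSpace ℝ (Fin n))
        (fun x : Sph n => TangentSpace (𝓡 n) x) x).symm z v) := by
      intro v
      change (trivializationAt (EuclideanSpace ℝ (Fin (n + 1)))
        (TangentSpace 𝓘(ℝ, EuclideanSpace ℝ (Fin (n + 1))))
          (x : EuclideanSpace ℝ (Fin (n + 1)))).continuousLinearMapAt ℝ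
            (z : EuclideanSpace ℝ (Fin (n + 1))) (inclDeriv n z ((trivializationAt
              (EuclideanSpace ℝ (Fin n)) (TangentSpace (𝓡 n)) x).symmL ℝ z v)) = _
      rw [TangentBundle.continuousLinearMapAt_model_space, Bundle.Trivialization.symmL_apply _ hz]
      rfl
    erw [inCoordinates_apply_eq₂ hz hz (by simp)]
    change _ = ⟪D z v, D z w⟫_ℝ
    rw [e1, e1]
    simp
    rfl

/-- The Gram matrix of `g` at `x` in the standard frame of the tangent space at `x`. -/
def gram {n : ℕ} (g : SmoothMetric n (Sph n)) (x : Sph n) : Matrix (Fin n) (Fin n) ℝ :=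
  Matrix.of fun i j => g.inner x (EuclideanSpace.single i (1 : ℝ) : EuclideanSpace ℝ (Fin n))
    (EuclideanSpace.single j (1 : ℝ) : EuclideanSpace ℝ (Fin n))

/-- The Riemannian volume measure `dV_g` of a metric `g` on `Sⁿ`. For the round metric it is the
standard surface measure `volume.toSphere`, and `dV_g = √(det g / det g₀) dV_{g₀}`, a ratio that
does not depend on the frame in which the Gram matrices are computed. -/
def riemannianVolume {n : ℕ} (g : SmoothMetric n (Sph n)) : Measure (Sph n) :=
  (volume : Measure (EuclideanSpace ℝ (Fin (n + 1)))).toSphere.withDensity fun x =>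
    ENNReal.ofReal √((gram g x).det / (gram (roundMetric n) x).det)

/-- `lam` is an eigenvalue of the conformal Laplacian `□_g = -Δ_g + cₙ R_g` of `(Sⁿ, g)`: the
equation `□_g u = lam u` has a nonzero solution `u ∈ L²(dV_g)`, in the sense of distributions
(by elliptic regularity such a solution is smooth, and `□_g` is formally self-adjoint). -/
def IsEigenvalue {n : ℕ} (g : SmoothMetric n (Sph n)) (lam : ℝ) : Prop :=
  ∃ u : Sph n → ℝ, MemLp u 2 (riemannianVolume g) ∧ ¬ u =ᵐ[riemannianVolume g] 0 ∧
    ∀ φ : SmoothFun n (Sph n),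
      ∫ x, u x * conformalLaplacian g φ x ∂riemannianVolume g =
        lam * ∫ x, u x * φ x ∂riemannianVolume g

/-- The lowest eigenvalue `λ₀(g)` of the conformal Laplacian of `(Sⁿ, g)`. -/
def lowestEigenvalue {n : ℕ} (g : SmoothMetric n (Sph n)) : ℝ :=
  sInf {lam : ℝ | IsEigenvalue g lam}

/-- The functional `λ₀(g̃) ∫ μ ^ (4 / (n - 2)) dV_g` for `g̃ = μ ^ (4 / (n - 2)) g`. -/
def lambdaBar {n : ℕ} (g : SmoothMetric n (Sph n)) (μ : PosFun n (Sph n)) : ℝ :=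
  lowestEigenvalue (conformalMetric g μ) *
    ∫ x, (μ.1 x ^ (4 / ((n : ℝ) - 2)) : ℝ) ∂riemannianVolume g

/-- The supremum `Λ₀(Sⁿ, g)` of the functional over the conformal class of `g`. -/
def LambdaSup {n : ℕ} (g : SmoothMetric n (Sph n)) : ℝ :=
  ⨆ μ : PosFun n (Sph n), lambdaBar g μ

end ConformalSphere

end

noncomputable section

namespace ConformalSphere

/-! ### Compact positive operators -/

section Hilbert

variable {H : Type*} [NormedAddCommGroup H] [InnerProductSpace ℝ H]

/-! Write ρ = μ ^ (4 / (n - 2)), c = n (n - 2) / 4, V for the volume of the round sphere and □ = -Δ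
+ c for its conformal Laplacian. Conformal covariance (`conformalLaplacian_conformalMetric`) turns
the eigenvalue equation of ρ g₀ for u into □ w = λ ρ w on the round sphere, with w = μ u. The
Rayleigh quotient ⟪□ w, w⟫ / ∫ ρ w² equals c V / ∫ ρ at w = 1, which suggests λ₀ ∫ ρ ≤ c V, the
value at the round metric.

The argument runs on the dual side, with K = □⁻¹, so that only bounded operators on L² occur. Weak
solutions are exactly the solutions of w = λ K (ρ w) (`isWeakSolution_iff`). The operator T = √ρ K
√ρ is compact and positive, hence ‖T‖⁻¹ is an eigenvalue of the weighted problem, and the Rayleigh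
quotient of T at √ρ gives λ₀ ⟪Kρ, ρ⟫ ≤ ∫ ρ (`exists_isWeakSolution`, `lowestEigenvalue_mul_le`).
Since K 1 = c⁻¹, the inequality ⟪K(ρ - t), ρ - t⟫ ≥ 0 with t the mean of ρ reads (∫ ρ)² ≤ c V ⟪Kρ,
ρ⟫ (`inner_greenOperator_ge`). Multiplying the two bounds gives λ₀ ∫ ρ ≤ c V. Equality forces ⟪K(ρ -
t), ρ - t⟫ = 0, and K is definite, so ρ = t.

The inverse K comes from an explicit diagonalisation of □. On powers ⟪a, x⟫ ^ k the Laplacian is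
triangular with respect to the degree; as it is also symmetric, the orthogonal increments of the
filtration by degree are eigenspaces, with eigenvalues k (k + n - 1) + c (`boxGraph_harmonicL2`).
They are complete because the exponentials of linear forms span an algebra that separates points.
Symmetry is Green's identity in ℝⁿ⁺¹ for extensions constant along rays
(`integral_mul_sphereLaplacian_comm`). -/

/-- A compact positive operator has its norm as an eigenvalue. -/
theorem exists_eigenvector_norm [CompleteSpace H] {T : H →L[ℝ] H} (hT : IsCompactOperator T)
    (hsymm : T.IsSymmetric) (hpos : ∀ x, 0 ≤ ⟪T x, x⟫_ℝ) (h0 : T ≠ 0) :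
    ∃ v : H, v ≠ 0 ∧ T v = ‖T‖ • v := by
  have hne : ‖T‖ ≠ 0 := norm_ne_zero_iff.2 h0
  have : Nontrivial H := by
    by_contra h
    rw [not_nontrivial_iff_subsingleton] at h
    exact h0 (ContinuousLinearMap.ext fun x => Subsingleton.elim _ _)
  -- Fredholm alternative: if ‖T‖ is not an eigenvalue it lies in the resolvent set, and then the
  -- Rayleigh quotients stay below ‖T‖ - ε. Positivity removes the absolute value, which contradicts
  -- that ‖T‖ is the supremum of |Rayleigh quotient| for a symmetric operator.
  rcases hT.hasEigenvalue_or_mem_resolventSet hne with h | h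
  · obtain ⟨v, hv⟩ := h.exists_hasEigenvector
    exact ⟨v, hv.2, hv.apply_eq_smul⟩
  · exfalso
    obtain ⟨ε, hε, hle⟩ := T.rayleighQuotient_le_of_norm_mem_resolventSet (𝕜 := ℝ) h
    have h1 := T.norm_eq_iSup_rayleighQuotient hsymm
    have h2 : ⨆ x, |T.rayleighQuotient x| ≤ ‖T‖ - ε := by
      refine ciSup_le fun x => ?_
      rw [abs_of_nonneg]
      · exact hle x
      · exact div_nonneg (hpos x) (by positivity)
    linarith

/-- The operator that multiplies by `κ k` on the `k`-th of a sequence of subspaces. -/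
def diagonalOperator (W : ℕ → Submodule ℝ H) [∀ k, FiniteDimensional ℝ (W k)] (κ : ℕ → ℝ) :
    H →L[ℝ] H :=
  ∑' k, κ k • (W k).starProjection

variable {W : ℕ → Submodule ℝ H} [∀ k, FiniteDimensional ℝ (W k)] {κ : ℕ → ℝ}

/-- Projections have norm at most 1, so the series converges in operator norm as soon as `κ` is
summable; the dimensions of the subspaces play no role. -/
theorem hasSum_diagonalOperator [CompleteSpace H] (hκ : Summable κ) (hκ0 : ∀ k, 0 ≤ κ k) :
    HasSum (fun k => κ k • (W k).starProjection) (diagonalOperator W κ) := by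
  refine Summable.hasSum (Summable.of_norm_bounded hκ fun k => ?_)
  rw [norm_smul, Real.norm_of_nonneg (hκ0 k)]
  exact mul_le_of_le_one_right (hκ0 k) (W k).starProjection_norm_le

theorem hasSum_inner_diagonalOperator [CompleteSpace H] (hκ : Summable κ) (hκ0 : ∀ k, 0 ≤ κ k)
    (x y : H) :
    HasSum (fun k => κ k * ⟪(W k).starProjection x, y⟫_ℝ) ⟪diagonalOperator W κ x, y⟫_ℝ := by
  have h := (hasSum_diagonalOperator (W := W) hκ hκ0).mapL
    ((innerSL ℝ y).comp (ContinuousLinearMap.apply ℝ H x))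
  simpa [real_inner_comm, inner_smul_left] using h

/-- The partial sums have finite rank and converge in norm. -/
theorem isCompactOperator_diagonalOperator [CompleteSpace H] (hκ : Summable κ)
    (hκ0 : ∀ k, 0 ≤ κ k) : IsCompactOperator (diagonalOperator W κ) := by
  refine isCompactOperator_of_tendsto (hasSum_diagonalOperator (W := W) hκ hκ0)
    (Filter.Eventually.of_forall fun s => ?_)
  have h1 : ∀ k, IsCompactOperator ((κ k • (W k).starProjection : H →L[ℝ] H)) := fun k => by
    have : IsCompactOperator (W k).orthogonalProjectionOnto :=
      isCompactOperator_of_locallyCompactSpace_dom (W k).orthogonalProjectionOnto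
    exact (this.clm_comp (W k).subtypeL).smul (κ k)
  induction s using Finset.cons_induction with
  | empty => simpa using isCompactOperator_zero
  | cons a s ha ih => rw [Finset.sum_cons]; exact (h1 a).add ih

theorem isSymmetric_diagonalOperator [CompleteSpace H] (hκ : Summable κ) (hκ0 : ∀ k, 0 ≤ κ k) :
    (diagonalOperator W κ).IsSymmetric := by
  intro x y
  refine (hasSum_inner_diagonalOperator (W := W) hκ hκ0 x y).unique ?_
  have h := hasSum_inner_diagonalOperator (W := W) hκ hκ0 y x
  rw [real_inner_comm] at h
  convert! h using 1; funext k
  rw [real_inner_comm _ ((W k).starProjection y), (W k).inner_starProjection_left_eq_right]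

theorem inner_diagonalOperator_nonneg [CompleteSpace H] (hκ : Summable κ) (hκ0 : ∀ k, 0 ≤ κ k)
    (x : H) : 0 ≤ ⟪diagonalOperator W κ x, x⟫_ℝ :=
  (hasSum_inner_diagonalOperator hκ hκ0 x x).nonneg fun k =>
    mul_nonneg (hκ0 k) (by simpa using (W k).re_inner_starProjection_nonneg x)

/-- The quadratic form is a sum of the nonnegative terms `κ k` times the squared norm of the k-th
projection, so each term vanishes. For a complete family this makes the operator definite. -/
theorem mem_orthogonal_of_inner_diagonalOperator_eq_zero [CompleteSpace H] (hκ : Summable κ)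
    (hκ0 : ∀ k, 0 < κ k) {x : H} (h : ⟪diagonalOperator W κ x, x⟫_ℝ = 0) (k : ℕ) :
    x ∈ (W k)ᗮ := by
  have h1 := hasSum_inner_diagonalOperator (W := W) hκ (fun k => (hκ0 k).le) x x
  rw [h] at h1
  have h2 := (hasSum_zero_iff_of_nonneg fun k => mul_nonneg (hκ0 k).le
    (by simpa using (W k).re_inner_starProjection_nonneg x)).1 h1
  have h3 := (mul_eq_zero.1 (congr_fun h2 k)).resolve_left (hκ0 k).ne'
  have h4 := (W k).re_inner_starProjection_eq_normSq x
  rw [← (W k).starProjection_apply_eq_zero_iff, ← norm_eq_zero]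
  simpa [h3] using h4.symm

theorem diagonalOperator_apply_of_mem [CompleteSpace H] (hκ : Summable κ) (hκ0 : ∀ k, 0 ≤ κ k)
    (hW : ∀ j k, j ≠ k → W j ⟂ W k) {k : ℕ} {x : H} (hx : x ∈ W k) :
    diagonalOperator W κ x = κ k • x := by
  have h := (hasSum_diagonalOperator (W := W) hκ hκ0).mapL (ContinuousLinearMap.apply ℝ H x)
  have h' := hasSum_single (f := fun j => ContinuousLinearMap.apply ℝ H x
    (κ j • (W j).starProjection)) k fun j hj => by
      have : (W j).starProjection x = 0 :=
        (W j).starProjection_apply_eq_zero_iff.2 (hW k j hj.symm hx)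
      simp [this]
  have h2 := h.unique h'
  simpa [Submodule.starProjection_eq_self_iff.2 hx] using h2

end Hilbert

/-! ### The conformal Laplacian of a conformally flat metric -/

section ConformallyFlat

variable {n : ℕ}

theorem contDiff_partialD {f : EuclideanSpace ℝ (Fin n) → ℝ} (hf : ContDiff ℝ ∞ f) (i : Fin n) :
    ContDiff ℝ ∞ (partialD i f) :=
  (hf.fderiv_right (m := ∞) (by simp)).clm_apply contDiff_const

theorem partialD_mul {f g : EuclideanSpace ℝ (Fin n) → ℝ} {y : EuclideanSpace ℝ (Fin n)}
    (hf : DifferentiableAt ℝ f y) (hg : DifferentiableAt ℝ g y) (i : Fin n) :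
    partialD i (fun z => f z * g z) y = f y * partialD i g y + partialD i f y * g y := by
  simp only [partialD]
  rw [fderiv_fun_mul hf hg]
  simp [mul_comm]

theorem partialD_add {f g : EuclideanSpace ℝ (Fin n) → ℝ} {y : EuclideanSpace ℝ (Fin n)}
    (hf : DifferentiableAt ℝ f y) (hg : DifferentiableAt ℝ g y) (i : Fin n) :
    partialD i (fun z => f z + g z) y = partialD i f y + partialD i g y := by
  simp only [partialD]
  rw [fderiv_fun_add hf hg]
  simp

theorem partialD_sub {f g : EuclideanSpace ℝ (Fin n) → ℝ} {y : EuclideanSpace ℝ (Fin n)}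
    (hf : DifferentiableAt ℝ f y) (hg : DifferentiableAt ℝ g y) (i : Fin n) :
    partialD i (fun z => f z - g z) y = partialD i f y - partialD i g y := by
  simp only [partialD]
  rw [fderiv_fun_sub hf hg]
  simp

theorem partialD_const_mul {f : EuclideanSpace ℝ (Fin n) → ℝ} {y : EuclideanSpace ℝ (Fin n)}
    (hf : DifferentiableAt ℝ f y) (c : ℝ) (i : Fin n) :
    partialD i (fun z => c * f z) y = c * partialD i f y := by
  simp only [partialD]
  rw [fderiv_const_mul hf]
  simp

/-- The Laplacian of `ℝⁿ`. -/
def flatLaplacian (f : EuclideanSpace ℝ (Fin n) → ℝ) (y : EuclideanSpace ℝ (Fin n)) : ℝ :=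
  ∑ i, partialD i (partialD i f) y

theorem flatLaplacian_mul {f g : EuclideanSpace ℝ (Fin n) → ℝ} (hf : ContDiff ℝ ∞ f)
    (hg : ContDiff ℝ ∞ g) (y : EuclideanSpace ℝ (Fin n)) :
    flatLaplacian (fun z => f z * g z) y = f y * flatLaplacian g y
      + 2 * ∑ i, partialD i f y * partialD i g y + flatLaplacian f y * g y := by
  have d : ∀ {u : EuclideanSpace ℝ (Fin n) → ℝ}, ContDiff ℝ ∞ u → ∀ y, DifferentiableAt ℝ u y :=
    fun hu y => hu.differentiable (by simp) y
  have h1 : ∀ i, partialD i (partialD i fun z => f z * g z) y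
      = f y * partialD i (partialD i g) y + 2 * (partialD i f y * partialD i g y)
        + partialD i (partialD i f) y * g y := by
    intro i
    have : partialD i (fun z => f z * g z)
        = fun z => f z * partialD i g z + partialD i f z * g z :=
      funext fun z => partialD_mul (d hf z) (d hg z) i
    have hfi := contDiff_partialD hf i
    have hgi := contDiff_partialD hg i
    rw [this, partialD_add (d (hf.mul hgi) y) (d (hfi.mul hg) y),
      partialD_mul (d hf y) (d hgi y), partialD_mul (d hfi y) (d hg y)]
    ring
  simp only [flatLaplacian, h1, Finset.sum_add_distrib, Finset.mul_sum, Finset.sum_mul]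

theorem christoffel_smul_one {h : EuclideanSpace ℝ (Fin n) → ℝ} {y : EuclideanSpace ℝ (Fin n)}
    (hy : h y ≠ 0) (k i j : Fin n) :
    christoffel (fun z => h z • (1 : Matrix (Fin n) (Fin n) ℝ)) k i j y =
      (if j = k then (1 / 2 * (h y)⁻¹ * partialD i h y) else 0)
      + (if i = k then (1 / 2 * (h y)⁻¹ * partialD j h y) else 0)
      - (if i = j then (1 / 2 * (h y)⁻¹ * partialD k h y) else 0) := by
  have hinv : (h y • (1 : Matrix (Fin n) (Fin n) ℝ))⁻¹ = (h y)⁻¹ • 1 := by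
    apply Matrix.inv_eq_left_inv
    simp [smul_smul, hy]
  have hp : ∀ i j l : Fin n, partialD i (fun z => (h z • (1 : Matrix (Fin n) (Fin n) ℝ)) j l) y
      = if j = l then partialD i h y else 0 := by
    intro i j l
    by_cases hjl : j = l
    · simp [hjl]
    · simp [hjl, partialD]
  simp only [christoffel, hinv, hp]
  simp only [Matrix.smul_apply, Matrix.one_apply, smul_eq_mul, mul_ite, mul_one, mul_zero, ite_mul, zero_mul, Finset.sum_ite_eq,
    Finset.mem_univ, if_true]
  split_ifs <;> ring

/-- The algebra behind the scalar curvature of h δ: `a i` stands for ∂ᵢ of f = ½ log h, and `A m i`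
for ∂ₘ of it. It is the identity R e^{2f} = -2(n-1) Δf - (n-1)(n-2) |∇f|². Only the diagonal of `A`
survives the trace, so its symmetry is not needed. -/
theorem ricci_trace_identity (a : Fin n → ℝ) (A : Fin n → Fin n → ℝ) :
    ∑ i, (∑ k, (((if i = k then A k i else 0) + (if i = k then A k i else 0)
        - (if i = i then A k k else 0))
      - ((if k = k then A i i else 0) + (if i = k then A i k else 0)
        - (if i = k then A i k else 0)))
      + ∑ k, ∑ l, (((if l = k then a k else 0) + (if k = k then a l else 0)
          - (if k = l then a k else 0))
        * ((if i = l then a i else 0) + (if i = l then a i else 0) - (if i = i then a l else 0))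
        - ((if l = k then a i else 0) + (if i = k then a l else 0) - (if i = l then a k else 0))
        * ((if k = l then a i else 0) + (if i = l then a k else 0) - (if i = k then a l else 0))))
    = -2 * ((n : ℝ) - 1) * ∑ i, A i i - ((n : ℝ) - 1) * ((n : ℝ) - 2) * ∑ i, a i ^ 2 := by
  have e1 : ∀ i k l : Fin n, ((if l = k then a i else 0) + (if i = k then a l else 0)
      - (if i = l then a k else 0)) * ((if k = l then a i else 0) + (if i = l then a k else 0)
        - (if i = k then a l else 0))
      = (if k = l then a i ^ 2 else 0) - (if i = k then a l ^ 2 else 0)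
        - (if i = l then a k ^ 2 else 0)
        + 2 * (if i = k then (if i = l then a i ^ 2 else 0) else 0) := by
    intro i k l
    by_cases h1 : k = l
    · subst h1; by_cases h2 : i = k
      · subst h2; simp; ring
      · simp [h2]; ring
    · by_cases h2 : i = k
      · subst h2; simp [h1, Ne.symm h1]; ring
      · by_cases h3 : i = l
        · subst h3; simp [h1, h2]; ring
        · simp [h1, Ne.symm h1, h2, h3]
  have e2 : ∀ i k l : Fin n, ((if l = k then a k else 0) + a l - (if k = l then a k else 0))
        * ((if i = l then a i else 0) + (if i = l then a i else 0) - a l)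
        = 2 * (if i = l then a i ^ 2 else 0) - a l ^ 2 := by
    intro i k l
    have : (if l = k then a k else 0) = (if k = l then a k else 0) := by simp [eq_comm]
    rw [this]
    by_cases h : i = l
    · subst h; simp; ring
    · simp [h]; ring
  have e3 : ∀ (p : Prop) [Decidable p] (f : Fin n → ℝ),
      ∑ l, (if p then f l else 0) = if p then ∑ l, f l else 0 := by
    intro p _ f
    split_ifs <;> simp
  simp only [if_true, e1, e2]
  simp only [Finset.sum_add_distrib, Finset.sum_sub_distrib, ← Finset.mul_sum, Finset.sum_ite_eq,
    e3, Finset.mem_univ, if_true, Finset.sum_const, Finset.card_univ, Fintype.card_fin, nsmul_eq_mul]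
  ring

theorem scalarCoord_smul_one {h : EuclideanSpace ℝ (Fin n) → ℝ} (hh : ContDiff ℝ ∞ h)
    (h0 : ∀ y, h y ≠ 0) (y : EuclideanSpace ℝ (Fin n)) :
    scalarCoord (fun z => h z • (1 : Matrix (Fin n) (Fin n) ℝ)) y =
      (h y)⁻¹ * (-2 * ((n : ℝ) - 1) * ∑ i, partialD i (fun z => 1 / 2 * (h z)⁻¹ * partialD i h z) y
        - ((n : ℝ) - 1) * ((n : ℝ) - 2) * ∑ i, (1 / 2 * (h y)⁻¹ * partialD i h y) ^ 2) := by
  set a : Fin n → EuclideanSpace ℝ (Fin n) → ℝ :=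
    fun i z => 1 / 2 * (h z)⁻¹ * partialD i h z with ha
  have hΓ : ∀ k i j, christoffel (fun z => h z • (1 : Matrix (Fin n) (Fin n) ℝ)) k i j
      = fun z => (if j = k then a i z else 0) + (if i = k then a j z else 0)
        - (if i = j then a k z else 0) :=
    fun k i j => funext fun z => christoffel_smul_one (h0 z) k i j
  have had : ∀ i, DifferentiableAt ℝ (a i) y := fun i =>
    (((contDiff_const.mul (hh.inv h0)).mul (contDiff_partialD hh i)).differentiable (by simp)) y
  have hite : ∀ (p : Prop) [Decidable p] (i : Fin n),
      DifferentiableAt ℝ (fun z => if p then a i z else 0) y := by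
    intro p _ i
    split_ifs
    · exact had i
    · exact differentiableAt_const _
  have hpite : ∀ (p : Prop) [Decidable p] (m i : Fin n),
      partialD m (fun z => if p then a i z else 0) y = if p then partialD m (a i) y else 0 := by
    intro p _ m i
    split_ifs
    · rfl
    · simp [partialD]
  have hdΓ : ∀ m k i j, partialD m
      (christoffel (fun z => h z • (1 : Matrix (Fin n) (Fin n) ℝ)) k i j) y
      = (if j = k then partialD m (a i) y else 0) + (if i = k then partialD m (a j) y else 0)
        - (if i = j then partialD m (a k) y else 0) := by
    intro m k i j
    have h1 := partialD_sub ((hite (j = k) i).fun_add (hite (i = k) j)) (hite (i = j) k) m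
    have h2 := partialD_add (hite (j = k) i) (hite (i = k) j) m
    rw [hΓ, h1, h2, hpite, hpite, hpite]
  have hinv : (h y • (1 : Matrix (Fin n) (Fin n) ℝ))⁻¹ = (h y)⁻¹ • 1 := by
    apply Matrix.inv_eq_left_inv
    simp [smul_smul, h0 y]
  have htr : scalarCoord (fun z => h z • (1 : Matrix (Fin n) (Fin n) ℝ)) y
      = (h y)⁻¹ * ∑ i, ricciCoord (fun z => h z • (1 : Matrix (Fin n) (Fin n) ℝ)) i i y := by
    simp [scalarCoord, hinv, Matrix.one_apply, Finset.mul_sum]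
  rw [htr, ← ricci_trace_identity (fun i => a i y) fun m i => partialD m (a i) y]
  simp only [ricciCoord, hdΓ]
  simp only [hΓ]

theorem laplaceCoord_smul_one {h f : EuclideanSpace ℝ (Fin n) → ℝ}
    {y : EuclideanSpace ℝ (Fin n)} (hy : h y ≠ 0) :
    laplaceCoord (fun z => h z • (1 : Matrix (Fin n) (Fin n) ℝ)) f y =
      (h y)⁻¹ * (flatLaplacian f y
        + ((n : ℝ) - 2) * ∑ i, 1 / 2 * (h y)⁻¹ * partialD i h y * partialD i f y) := by
  have hinv : (h y • (1 : Matrix (Fin n) (Fin n) ℝ))⁻¹ = (h y)⁻¹ • 1 := by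
    apply Matrix.inv_eq_left_inv
    simp [smul_smul, hy]
  have h1 : laplaceCoord (fun z => h z • (1 : Matrix (Fin n) (Fin n) ℝ)) f y
      = (h y)⁻¹ * ∑ i, (partialD i (partialD i f) y
        - ∑ k, christoffel (fun z => h z • (1 : Matrix (Fin n) (Fin n) ℝ)) k i i y
          * partialD k f y) := by
    rw [Finset.mul_sum]
    simp [laplaceCoord, hinv, Matrix.one_apply]
  rw [h1]
  congr 1
  simp only [christoffel_smul_one hy, flatLaplacian]
  simp only [add_mul, sub_mul, ite_mul, zero_mul, Finset.sum_add_distrib, Finset.sum_sub_distrib,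
    Finset.sum_ite_eq, Finset.mem_univ, if_true, Finset.sum_const, Finset.card_univ,
    Fintype.card_fin, nsmul_eq_mul]
  ring

/-- The conformal Laplacian of the metric `ψ ^ (4 / (n - 2)) δ` is
`f ↦ -ψ ^ (-(n + 2) / (n - 2)) Δ (ψ f)`. -/
theorem conformalLaplacian_conformallyFlat (hn : 3 ≤ n) {ψ f : EuclideanSpace ℝ (Fin n) → ℝ}
    (hψ : ContDiff ℝ ∞ ψ) (hf : ContDiff ℝ ∞ f) (h0 : ∀ y, 0 < ψ y)
    (y : EuclideanSpace ℝ (Fin n)) :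
    -laplaceCoord (fun z => ψ z ^ (4 / ((n : ℝ) - 2)) • (1 : Matrix (Fin n) (Fin n) ℝ)) f y
      + ((n : ℝ) - 2) / (4 * ((n : ℝ) - 1))
        * scalarCoord (fun z => ψ z ^ (4 / ((n : ℝ) - 2)) • (1 : Matrix (Fin n) (Fin n) ℝ)) y * f y
    = -((ψ y ^ (4 / ((n : ℝ) - 2)))⁻¹ * (ψ y)⁻¹ * flatLaplacian (fun z => ψ z * f z) y) := by
  have hn' : (3 : ℝ) ≤ n := by exact_mod_cast hn
  have hn2 : (n : ℝ) - 2 ≠ 0 := by linarith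
  have hn1 : (n : ℝ) - 1 ≠ 0 := by linarith
  set p : ℝ := 4 / ((n : ℝ) - 2) with hp
  set h : EuclideanSpace ℝ (Fin n) → ℝ := fun z => ψ z ^ p with hh
  have hpos : ∀ z, 0 < h z := fun z => Real.rpow_pos_of_pos (h0 z) _
  have hhs : ContDiff ℝ ∞ h := hψ.rpow_const_of_ne fun z => (h0 z).ne'
  have d : ∀ {u : EuclideanSpace ℝ (Fin n) → ℝ}, ContDiff ℝ ∞ u → ∀ y, DifferentiableAt ℝ u y :=
    fun hu y => hu.differentiable (by simp) y
  -- Since h = ψ ^ (4 / (n - 2)), ½ ∂ log h = 2 / (n - 2) · ∂ log ψ. This exponent is the one for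
  -- which the |∇ψ|² terms of the scalar curvature cancel in the final `ring`.
  have hdh : ∀ i z, 1 / 2 * (h z)⁻¹ * partialD i h z
      = 2 / ((n : ℝ) - 2) * ((ψ z)⁻¹ * partialD i ψ z) := by
    intro i z
    have e : partialD i h z = p * ψ z ^ (p - 1) * partialD i ψ z := by
      have := (d hψ z).hasFDerivAt.rpow_const (p := p) (Or.inl (h0 z).ne')
      simp only [partialD, hh]
      rw [this.fderiv]
      simp
    rw [e, Real.rpow_sub_one (h0 z).ne']
    have := (hpos z).ne'
    have h3 := (h0 z).ne'
    simp only [hh] at this ⊢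
    rw [hp] at this ⊢
    field_simp
    ring
  have hdd : ∀ i, partialD i (fun z => 1 / 2 * (h z)⁻¹ * partialD i h z) y
      = 2 / ((n : ℝ) - 2) * ((ψ y)⁻¹ * partialD i (partialD i ψ) y
        - (ψ y)⁻¹ ^ 2 * partialD i ψ y ^ 2) := by
    intro i
    have hi : ContDiff ℝ ∞ fun z => (ψ z)⁻¹ := hψ.inv fun z => (h0 z).ne'
    have hinv : partialD i (fun z => (ψ z)⁻¹) y = -(ψ y)⁻¹ ^ 2 * partialD i ψ y := by
      have := (hasDerivAt_inv (h0 y).ne').comp_hasFDerivAt y (d hψ y).hasFDerivAt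
      simp only [partialD]
      rw [show (fun z => (ψ z)⁻¹) = Inv.inv ∘ ψ from rfl, this.fderiv]
      simp
    rw [show (fun z => 1 / 2 * (h z)⁻¹ * partialD i h z)
      = fun z => 2 / ((n : ℝ) - 2) * ((ψ z)⁻¹ * partialD i ψ z) from funext fun z => hdh i z,
      partialD_const_mul (d (hi.mul (contDiff_partialD hψ i)) y),
      partialD_mul (d hi y) (d (contDiff_partialD hψ i) y), hinv]
    ring
  have e1 := scalarCoord_smul_one hhs (fun z => (hpos z).ne') y
  have e2 := laplaceCoord_smul_one (f := f) (hpos y).ne'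
  have e3 := flatLaplacian_mul hψ hf y
  rw [e1, e2, e3]
  simp only [hdd]
  simp only [hdh]
  have s1 : ∑ i, 2 / ((n : ℝ) - 2) * ((ψ y)⁻¹ * partialD i (partialD i ψ) y
        - (ψ y)⁻¹ ^ 2 * partialD i ψ y ^ 2)
      = 2 / ((n : ℝ) - 2) * ((ψ y)⁻¹ * flatLaplacian ψ y
        - (ψ y)⁻¹ ^ 2 * ∑ i, partialD i ψ y ^ 2) := by
    simp only [flatLaplacian, ← Finset.mul_sum, Finset.sum_sub_distrib]
  have s2 : ∑ i, (2 / ((n : ℝ) - 2) * ((ψ y)⁻¹ * partialD i ψ y)) ^ 2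
      = (2 / ((n : ℝ) - 2)) ^ 2 * (ψ y)⁻¹ ^ 2 * ∑ i, partialD i ψ y ^ 2 := by
    simp only [Finset.mul_sum, mul_pow, mul_assoc]
  have s3 : ∑ i, 2 / ((n : ℝ) - 2) * ((ψ y)⁻¹ * partialD i ψ y) * partialD i f y
      = 2 / ((n : ℝ) - 2) * (ψ y)⁻¹ * ∑ i, partialD i ψ y * partialD i f y := by
    simp only [Finset.mul_sum, mul_assoc]
  rw [s1, s2, s3]
  have h3 := (h0 y).ne'
  have h4 := (hpos y).ne'
  simp only [hh] at h4
  rw [show h y = ψ y ^ p from rfl]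
  generalize ψ y ^ p = q at *
  field_simp
  ring

end ConformallyFlat

/-! ### The sphere in stereographic coordinates -/

section Stereographic

variable {n : ℕ}

/-- The isometric embedding onto the tangent space at `x` that underlies the chart at `x`. -/
def chartFrame (x : Sph n) :
    EuclideanSpace ℝ (Fin n) →ₗᵢ[ℝ] EuclideanSpace ℝ (Fin (n + 1)) :=
  have := Fact.mk (@finrank_euclideanSpace_fin ℝ _ (n + 1))
  (ℝ ∙ ((-x : Sph n) : EuclideanSpace ℝ (Fin (n + 1))))ᗮ.subtypeₗᵢ.comp
    (OrthonormalBasis.fromOrthogonalSpanSingleton n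
      (ne_zero_of_mem_unit_sphere (-x))).repr.symm.toLinearIsometry

theorem inner_chartFrame (x : Sph n) (y : EuclideanSpace ℝ (Fin n)) :
    ⟪chartFrame x y, (x : EuclideanSpace ℝ (Fin (n + 1)))⟫_ℝ = 0 := by
  have := Fact.mk (@finrank_euclideanSpace_fin ℝ _ (n + 1))
  have h : chartFrame x y ∈ (ℝ ∙ ((-x : Sph n) : EuclideanSpace ℝ (Fin (n + 1))))ᗮ :=
    ((OrthonormalBasis.fromOrthogonalSpanSingleton n
      (ne_zero_of_mem_unit_sphere (-x))).repr.symm y).2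
  rw [Submodule.mem_orthogonal_singleton_iff_inner_left] at h
  simpa using h

/-- The chart at `x` is stereographic projection from `-x`, so `x` has coordinate 0. The constants 4
correspond to projecting onto the tangent plane at `x`, which makes the conformal factor 4 / (‖y‖² +
4) equal to 1 at the origin. -/
theorem coe_chartAt_symm (x : Sph n) (y : EuclideanSpace ℝ (Fin n)) :
    (((chartAt (EuclideanSpace ℝ (Fin n)) x).symm y : Sph n) : EuclideanSpace ℝ (Fin (n + 1))) =
      (‖y‖ ^ 2 + 4)⁻¹ • ((4 : ℝ) • chartFrame x y
        + (4 - ‖y‖ ^ 2) • (x : EuclideanSpace ℝ (Fin (n + 1)))) := by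
  have := Fact.mk (@finrank_euclideanSpace_fin ℝ _ (n + 1))
  have h := stereographic'_symm_apply (n := n) (-x) y
  have hn : ‖y‖ = ‖chartFrame x y‖ := ((chartFrame x).norm_map y).symm
  rw [hn]
  refine h.trans ?_
  change (‖chartFrame x y‖ ^ 2 + 4)⁻¹ • (4 : ℝ) • chartFrame x y
    + (‖chartFrame x y‖ ^ 2 + 4)⁻¹ • (‖chartFrame x y‖ ^ 2 - 4)
      • ((-x : Sph n) : EuclideanSpace ℝ (Fin (n + 1))) = _
  rw [coe_neg_sphere]
  module

theorem chartAt_target (x : Sph n) : (chartAt (EuclideanSpace ℝ (Fin n)) x).target = univ := by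
  have := Fact.mk (@finrank_euclideanSpace_fin ℝ _ (n + 1))
  exact stereographic'_target (-x)

theorem chartAt_symm_zero (x : Sph n) :
    (chartAt (EuclideanSpace ℝ (Fin n)) x).symm 0 = x := by
  apply Subtype.ext
  rw [coe_chartAt_symm]
  simp [smul_smul]

theorem chartAt_self (x : Sph n) : chartAt (EuclideanSpace ℝ (Fin n)) x x = 0 := by
  have h := (chartAt (EuclideanSpace ℝ (Fin n)) x).right_inv (x := 0) (by simp [chartAt_target])
  rwa [chartAt_symm_zero] at h

theorem contMDiff_chartAt_symm (x : Sph n) :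
    ContMDiff (𝓡 n) (𝓡 n) ∞ (chartAt (EuclideanSpace ℝ (Fin n)) x).symm := by
  have h := contMDiffOn_chart_symm (I := 𝓡 n) (n := ∞) (x := x)
  rwa [chartAt_target, contMDiffOn_univ] at h

theorem contDiff_comp_chartAt_symm (φ : SmoothFun n (Sph n)) (x : Sph n) :
    ContDiff ℝ ∞ fun y => φ ((chartAt (EuclideanSpace ℝ (Fin n)) x).symm y) :=
  contMDiff_iff_contDiff.1 (φ.contMDiff.comp (contMDiff_chartAt_symm x))

theorem hasFDerivAt_norm_sq_add (y : EuclideanSpace ℝ (Fin n)) :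
    HasFDerivAt (fun z : EuclideanSpace ℝ (Fin n) => ‖z‖ ^ 2 + 4) (2 • innerSL ℝ y) y :=
  ((hasStrictFDerivAt_norm_sq y).hasFDerivAt).add_const 4

theorem fderiv_coe_chartAt_symm (x : Sph n) (y v : EuclideanSpace ℝ (Fin n)) :
    fderiv ℝ (fun z => (((chartAt (EuclideanSpace ℝ (Fin n)) x).symm z : Sph n) :
        EuclideanSpace ℝ (Fin (n + 1)))) y v =
      (4 * (‖y‖ ^ 2 + 4)⁻¹) • chartFrame x v
        - (8 * ⟪y, v⟫_ℝ * ((‖y‖ ^ 2 + 4) ^ 2)⁻¹) • chartFrame x y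
        - (16 * ⟪y, v⟫_ℝ * ((‖y‖ ^ 2 + 4) ^ 2)⁻¹) • (x : EuclideanSpace ℝ (Fin (n + 1))) := by
  have hpos : ‖y‖ ^ 2 + 4 ≠ 0 := by positivity
  have h1 := (hasDerivAt_inv hpos).comp_hasFDerivAt y (hasFDerivAt_norm_sq_add y)
  have h2 : HasFDerivAt (fun z => (4 : ℝ) • chartFrame x z
      + (4 - ‖z‖ ^ 2) • (x : EuclideanSpace ℝ (Fin (n + 1)))) _ y :=
    ((chartFrame x).toContinuousLinearMap.hasFDerivAt.const_smul (4 : ℝ)).add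
      (((hasStrictFDerivAt_norm_sq y).hasFDerivAt.const_sub 4).smul_const
        (x : EuclideanSpace ℝ (Fin (n + 1))))
  have h3 := h1.smul h2
  have e : (fun z => (((chartAt (EuclideanSpace ℝ (Fin n)) x).symm z : Sph n) :
        EuclideanSpace ℝ (Fin (n + 1)))) = (Inv.inv ∘ fun z : EuclideanSpace ℝ (Fin n) =>
          ‖z‖ ^ 2 + 4) • fun z => (4 : ℝ) • chartFrame x z
      + (4 - ‖z‖ ^ 2) • (x : EuclideanSpace ℝ (Fin (n + 1))) :=
    funext fun z => coe_chartAt_symm x z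
  rw [e, h3.fderiv]
  simp
  match_scalars <;> field_simp <;> ring

/-- Stereographic projection is conformal: the cross terms cancel because `chartFrame x` is
isometric with image orthogonal to `x`. -/
theorem inner_fderiv_coe_chartAt_symm (x : Sph n) (y v w : EuclideanSpace ℝ (Fin n)) :
    ⟪fderiv ℝ (fun z => (((chartAt (EuclideanSpace ℝ (Fin n)) x).symm z : Sph n) :
        EuclideanSpace ℝ (Fin (n + 1)))) y v,
      fderiv ℝ (fun z => (((chartAt (EuclideanSpace ℝ (Fin n)) x).symm z : Sph n) :
        EuclideanSpace ℝ (Fin (n + 1)))) y w⟫_ℝ =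
      (4 * (‖y‖ ^ 2 + 4)⁻¹) ^ 2 * ⟪v, w⟫_ℝ := by
  have hpos : ‖y‖ ^ 2 + 4 ≠ 0 := by positivity
  have hx : ⟪(x : EuclideanSpace ℝ (Fin (n + 1))), x⟫_ℝ = 1 := by
    rw [real_inner_self_eq_norm_sq]; simp
  have hx' : ∀ z, ⟪(x : EuclideanSpace ℝ (Fin (n + 1))), chartFrame x z⟫_ℝ = 0 := fun z => by
    rw [real_inner_comm, inner_chartFrame]
  simp only [fderiv_coe_chartAt_symm, inner_sub_left, inner_sub_right, inner_smul_left,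
    inner_smul_right, (chartFrame x).inner_map_map, inner_chartFrame, hx, hx',
    real_inner_self_eq_norm_sq, real_inner_comm y v]
  simp
  field_simp
  ring

theorem metricCoord_conformalMetric_roundMetric (μ : PosFun n (Sph n)) (x : Sph n)
    (y : EuclideanSpace ℝ (Fin n)) :
    metricCoord (conformalMetric (roundMetric n) μ) x y =
      (μ.1 ((chartAt (EuclideanSpace ℝ (Fin n)) x).symm y) ^ (4 / ((n : ℝ) - 2))
        * (4 * (‖y‖ ^ 2 + 4)⁻¹) ^ 2) • (1 : Matrix (Fin n) (Fin n) ℝ) := by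
  have hF := Fact.mk (@finrank_euclideanSpace_fin ℝ _ (n + 1))
  -- Chain rule: the differential of the inclusion after that of the inverse chart is the ordinary
  -- derivative of the explicit map into ℝⁿ⁺¹.
  have hcomp : ∀ v : EuclideanSpace ℝ (Fin n),
      inclDeriv n ((chartAt (EuclideanSpace ℝ (Fin n)) x).symm y)
        (mfderiv (𝓡 n) (𝓡 n) (chartAt (EuclideanSpace ℝ (Fin n)) x).symm y v)
      = fderiv ℝ (fun z => (((chartAt (EuclideanSpace ℝ (Fin n)) x).symm z : Sph n) :
        EuclideanSpace ℝ (Fin (n + 1)))) y v := by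
    intro v
    have h1 : MDifferentiableAt (𝓡 n) 𝓘(ℝ, EuclideanSpace ℝ (Fin (n + 1)))
        ((↑) : Sph n → EuclideanSpace ℝ (Fin (n + 1)))
        ((chartAt (EuclideanSpace ℝ (Fin n)) x).symm y) :=
      (contMDiff_coe_sphere (m := ∞) _).mdifferentiableAt (by simp)
    have h2 : MDifferentiableAt (𝓡 n) (𝓡 n) (chartAt (EuclideanSpace ℝ (Fin n)) x).symm y :=
      (contMDiff_chartAt_symm x y).mdifferentiableAt (by simp)
    have h3 := mfderiv_comp y h1 h2
    rw [mfderiv_eq_fderiv] at h3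
    exact (congrArg (fun L => L v) h3).symm
  ext i j
  have h4 := inner_fderiv_coe_chartAt_symm x y (EuclideanSpace.single i 1)
    (EuclideanSpace.single j 1)
  rw [← hcomp, ← hcomp] at h4
  have h5 : metricCoord (conformalMetric (roundMetric n) μ) x y i j
    = μ.1 ((chartAt (EuclideanSpace ℝ (Fin n)) x).symm y) ^ (4 / ((n : ℝ) - 2))
      * ⟪inclDeriv n ((chartAt (EuclideanSpace ℝ (Fin n)) x).symm y)
        (mfderiv (𝓡 n) (𝓡 n) (chartAt (EuclideanSpace ℝ (Fin n)) x).symm y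
          (EuclideanSpace.single i 1)),
        inclDeriv n ((chartAt (EuclideanSpace ℝ (Fin n)) x).symm y)
        (mfderiv (𝓡 n) (𝓡 n) (chartAt (EuclideanSpace ℝ (Fin n)) x).symm y
          (EuclideanSpace.single j 1))⟫_ℝ := rfl
  have h6 : ⟪EuclideanSpace.single i (1 : ℝ), EuclideanSpace.single j (1 : ℝ)⟫_ℝ
      = (1 : Matrix (Fin n) (Fin n) ℝ) i j := by
    simp [EuclideanSpace.inner_single_left, Matrix.one_apply]
  rw [h5, h4, h6, Matrix.smul_apply, smul_eq_mul, mul_assoc]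

/-- The stereographic conformal factor, raised to the power `(n - 2) / 2`. -/
def stereoFactor (n : ℕ) (y : EuclideanSpace ℝ (Fin n)) : ℝ :=
  (4 * (‖y‖ ^ 2 + 4)⁻¹) ^ (((n : ℝ) - 2) / 2)

theorem stereoFactor_pos (y : EuclideanSpace ℝ (Fin n)) : 0 < stereoFactor n y :=
  Real.rpow_pos_of_pos (by positivity) _

theorem stereoFactor_zero : stereoFactor n 0 = 1 := by
  simp [stereoFactor]

theorem contDiff_stereoFactor : ContDiff ℝ ∞ (stereoFactor n) := by
  refine ContDiff.rpow_const_of_ne (contDiff_const.mul (ContDiff.inv ?_ ?_)) ?_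
  · exact (contDiff_norm_sq ℝ).add contDiff_const
  · intro y; positivity
  · intro y; positivity

theorem partialD_stereoFactor (i : Fin n) (y : EuclideanSpace ℝ (Fin n)) :
    partialD i (stereoFactor n) y =
      y i * (-((n : ℝ) - 2) * (stereoFactor n y * (‖y‖ ^ 2 + 4)⁻¹)) := by
  have hpos : ‖y‖ ^ 2 + 4 ≠ 0 := by positivity
  have h1 := ((hasDerivAt_inv hpos).comp_hasFDerivAt y (hasFDerivAt_norm_sq_add y)).const_mul 4
  have h0 : 4 * (‖y‖ ^ 2 + 4)⁻¹ ≠ 0 := by positivity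
  have h2 := h1.rpow_const (p := ((n : ℝ) - 2) / 2) (Or.inl h0)
  have h3 : HasFDerivAt (stereoFactor n) _ y := h2
  rw [partialD, h3.fderiv]
  simp only [Function.comp, Real.rpow_sub_one h0, stereoFactor]
  simp [EuclideanSpace.inner_single_right]
  field_simp
  ring

/-- Each first partial derivative is `y i` times a smooth function, so its own derivative at 0 is
the value of that function there. This is the source of the constant n (n - 2) / 4. -/
theorem flatLaplacian_stereoFactor :
    flatLaplacian (stereoFactor n) 0 = -((n : ℝ) * ((n : ℝ) - 2) / 4) := by
  have h : ∀ i, partialD i (partialD i (stereoFactor n)) 0 = -((n : ℝ) - 2) / 4 := by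
    intro i
    have hc : ContDiff ℝ ∞ fun y : EuclideanSpace ℝ (Fin n) =>
        -((n : ℝ) - 2) * (stereoFactor n y * (‖y‖ ^ 2 + 4)⁻¹) := by
      refine contDiff_const.mul (contDiff_stereoFactor.mul (ContDiff.inv ?_ ?_))
      · exact (contDiff_norm_sq ℝ).add contDiff_const
      · intro y; positivity
    have hi : HasFDerivAt (fun y : EuclideanSpace ℝ (Fin n) => y i)
        (EuclideanSpace.proj i : EuclideanSpace ℝ (Fin n) →L[ℝ] ℝ) 0 :=
      (EuclideanSpace.proj i : EuclideanSpace ℝ (Fin n) →L[ℝ] ℝ).hasFDerivAt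
    rw [show partialD i (stereoFactor n) = fun y => y i * (-((n : ℝ) - 2) *
      (stereoFactor n y * (‖y‖ ^ 2 + 4)⁻¹)) from funext fun y => partialD_stereoFactor i y,
      partialD_mul hi.differentiableAt (hc.differentiable (by simp) 0)]
    simp only [partialD]
    rw [hi.fderiv]
    simp [stereoFactor_zero]
    ring
  simp only [flatLaplacian, h]
  simp
  ring

/-- The Laplacian of the round sphere. -/
def sphereLaplacian (φ : Sph n → ℝ) (x : Sph n) : ℝ :=
  flatLaplacian (fun y => φ ((chartAt (EuclideanSpace ℝ (Fin n)) x).symm y)) 0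

/-- The conformal Laplacian of the round sphere. -/
def sphereBox (φ : Sph n → ℝ) (x : Sph n) : ℝ :=
  -sphereLaplacian φ x + (n : ℝ) * ((n : ℝ) - 2) / 4 * φ x

/-- The gradient of `stereoFactor` vanishes at 0, so the product rule has no cross term: the
curvature of the sphere enters only through the zeroth-order constant. -/
theorem flatLaplacian_stereoFactor_mul (φ : SmoothFun n (Sph n)) (x : Sph n) :
    flatLaplacian (fun y => stereoFactor n y *
      φ ((chartAt (EuclideanSpace ℝ (Fin n)) x).symm y)) 0 = -sphereBox φ x := by
  rw [flatLaplacian_mul contDiff_stereoFactor (contDiff_comp_chartAt_symm φ x)]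
  simp [partialD_stereoFactor, stereoFactor_zero, flatLaplacian_stereoFactor, chartAt_symm_zero,
    sphereBox, sphereLaplacian]
  ring

/-- Conformal covariance of the conformal Laplacian on the sphere. -/
theorem conformalLaplacian_conformalMetric (hn : 3 ≤ n) (μ : PosFun n (Sph n))
    (φ : SmoothFun n (Sph n)) (x : Sph n) :
    conformalLaplacian (conformalMetric (roundMetric n) μ) φ x =
      (μ.1 x ^ (4 / ((n : ℝ) - 2)))⁻¹ * (μ.1 x)⁻¹ * sphereBox (μ.1 * φ : SmoothFun n (Sph n)) x := by
  have hn' : (3 : ℝ) ≤ n := by exact_mod_cast hn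
  have hn2 : (n : ℝ) - 2 ≠ 0 := by linarith
  set ψ : EuclideanSpace ℝ (Fin n) → ℝ := fun y =>
    stereoFactor n y * μ.1 ((chartAt (EuclideanSpace ℝ (Fin n)) x).symm y) with hψ
  -- In the chart at `x` the conformal metric is ψ ^ (4 / (n - 2)) δ, with ψ the product of the
  -- stereographic factor and μ, so the conformally flat formula applies at the origin.
  have hG : metricCoord (conformalMetric (roundMetric n) μ) x
      = fun y => ψ y ^ (4 / ((n : ℝ) - 2)) • (1 : Matrix (Fin n) (Fin n) ℝ) := by
    funext y
    rw [metricCoord_conformalMetric_roundMetric, hψ,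
      Real.mul_rpow (stereoFactor_pos y).le (μ.2 _).le, stereoFactor, ← Real.rpow_mul (by positivity)]
    rw [show ((n : ℝ) - 2) / 2 * (4 / ((n : ℝ) - 2)) = 2 by field_simp; norm_num, Real.rpow_two,
      mul_comm]
  have h := conformalLaplacian_conformallyFlat hn
    (contDiff_stereoFactor.mul (contDiff_comp_chartAt_symm μ.1 x))
    (contDiff_comp_chartAt_symm φ x) (fun y => mul_pos (stereoFactor_pos y) (μ.2 _)) 0
  have h2 := flatLaplacian_stereoFactor_mul (μ.1 * φ) x
  simp only [conformalLaplacian, laplaceBeltrami, scalarCurvature, hG, chartAt_self]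
  rw [chartAt_symm_zero, stereoFactor_zero, one_mul] at h
  have h3 : (fun y => stereoFactor n y * μ.1 ((chartAt (EuclideanSpace ℝ (Fin n)) x).symm y)
      * φ ((chartAt (EuclideanSpace ℝ (Fin n)) x).symm y)) = fun y => stereoFactor n y *
      (μ.1 * φ : SmoothFun n (Sph n)) ((chartAt (EuclideanSpace ℝ (Fin n)) x).symm y) := by
    funext y
    rw [mul_assoc]
    rfl
  rw [h3, h2] at h
  rw [mul_neg, neg_neg] at h
  exact h

end Stereographic

/-! ### The Laplacian of the sphere in terms of the ambient space -/

section Ambient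

variable {n : ℕ}

/-- The Laplacian of the ambient space `ℝⁿ⁺¹`. -/
def ambientLaplacian (G : EuclideanSpace ℝ (Fin n) → ℝ) (z : EuclideanSpace ℝ (Fin n)) : ℝ :=
  ∑ i, fderiv ℝ (fderiv ℝ G) z (EuclideanSpace.single i 1) (EuclideanSpace.single i 1)

theorem ambientLaplacian_eq_sum {ι : Type*} [Fintype ι]
    (b : OrthonormalBasis ι ℝ (EuclideanSpace ℝ (Fin n))) (G : EuclideanSpace ℝ (Fin n) → ℝ)
    (z : EuclideanSpace ℝ (Fin n)) :
    ambientLaplacian G z = ∑ i, fderiv ℝ (fderiv ℝ G) z (b i) (b i) := by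
  have h1 := congr_fun (InnerProductSpace.laplacian_eq_iteratedFDeriv_orthonormalBasis G b) z
  have h2 := congr_fun (InnerProductSpace.laplacian_eq_iteratedFDeriv_orthonormalBasis G
    (EuclideanSpace.basisFun (Fin n) ℝ)) z
  rw [h1] at h2
  simpa [iteratedFDeriv_two_apply, ambientLaplacian] using h2.symm

/-- The trace is taken in the orthonormal basis made of the normal `x` and the image of the chart
frame, which separates normal from tangential second derivatives. -/
theorem ambientLaplacian_eq_chartFrame (G : EuclideanSpace ℝ (Fin (n + 1)) → ℝ) (x : Sph n)
    (z : EuclideanSpace ℝ (Fin (n + 1))) :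
    ambientLaplacian G z = fderiv ℝ (fderiv ℝ G) z x x
      + ∑ i, fderiv ℝ (fderiv ℝ G) z (chartFrame x (EuclideanSpace.single i 1))
        (chartFrame x (EuclideanSpace.single i 1)) := by
  set v : Fin (n + 1) → EuclideanSpace ℝ (Fin (n + 1)) :=
    Fin.cons (x : EuclideanSpace ℝ (Fin (n + 1)))
      fun i => chartFrame x (EuclideanSpace.single i 1) with hv
  have hon : Orthonormal ℝ v := by
    constructor
    · intro i
      refine Fin.cases ?_ (fun i => ?_) i
      · simp [hv]
      · simp [hv]
    · intro i j
      refine Fin.cases ?_ (fun i => ?_) i <;> refine Fin.cases ?_ (fun j => ?_) j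
      · simp
      · intro _
        simp only [hv, Fin.cons_zero, Fin.cons_succ]
        rw [real_inner_comm, inner_chartFrame]
      · intro _
        simp only [hv, Fin.cons_zero, Fin.cons_succ]
        rw [inner_chartFrame]
      · intro hij
        have : i ≠ j := fun h => hij (by rw [h])
        simp [hv, EuclideanSpace.inner_single_left, this]
  have hsp : ⊤ ≤ Submodule.span ℝ (Set.range v) :=
    (hon.linearIndependent.span_eq_top_of_card_eq_finrank' (by simp)).ge
  rw [ambientLaplacian_eq_sum (OrthonormalBasis.mk hon hsp), OrthonormalBasis.coe_mk,
    Fin.sum_univ_succ]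
  simp [hv]

theorem contDiff_coe_chartAt_symm (x : Sph n) :
    ContDiff ℝ ∞ fun y => (((chartAt (EuclideanSpace ℝ (Fin n)) x).symm y : Sph n) :
      EuclideanSpace ℝ (Fin (n + 1))) := by
  have := Fact.mk (@finrank_euclideanSpace_fin ℝ _ (n + 1))
  exact contMDiff_iff_contDiff.1 (contMDiff_coe_sphere.comp (contMDiff_chartAt_symm x))

/-- To second order the coordinate lines through the origin are great circles, whose acceleration
points to the centre of the sphere. -/
theorem hasFDerivAt_fderiv_coe_chartAt_symm (x : Sph n) (v : EuclideanSpace ℝ (Fin n)) :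
    fderiv ℝ (fun y => fderiv ℝ (fun z => (((chartAt (EuclideanSpace ℝ (Fin n)) x).symm z :
      Sph n) : EuclideanSpace ℝ (Fin (n + 1)))) y v) 0 v =
      -‖v‖ ^ 2 • (x : EuclideanSpace ℝ (Fin (n + 1))) := by
  have hpos : ‖(0 : EuclideanSpace ℝ (Fin n))‖ ^ 2 + 4 ≠ 0 := by positivity
  have h1 := (hasDerivAt_inv hpos).comp_hasFDerivAt 0 (hasFDerivAt_norm_sq_add 0)
  have h2 := (hasDerivAt_inv (pow_ne_zero 2 hpos)).comp_hasFDerivAt 0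
    ((hasFDerivAt_norm_sq_add 0).pow 2)
  have hi : HasFDerivAt (fun y : EuclideanSpace ℝ (Fin n) => ⟪y, v⟫_ℝ) (innerSL ℝ v) 0 := by
    have := (innerSL ℝ v : EuclideanSpace ℝ (Fin n) →L[ℝ] ℝ).hasFDerivAt (x := 0)
    convert! this using 2 with y
    rw [innerSL_apply_apply, real_inner_comm]
  have hJ : HasFDerivAt (fun y => chartFrame x y) (chartFrame x).toContinuousLinearMap 0 :=
    (chartFrame x).toContinuousLinearMap.hasFDerivAt
  have h3 := (((h1.const_mul 4).smul_const (chartFrame x v)).fun_sub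
    (((hi.const_mul 8).mul h2).fun_smul hJ)).fun_sub
      (((hi.const_mul 16).mul h2).smul_const (x : EuclideanSpace ℝ (Fin (n + 1))))
  rw [show (fun y => fderiv ℝ (fun z => (((chartAt (EuclideanSpace ℝ (Fin n)) x).symm z :
      Sph n) : EuclideanSpace ℝ (Fin (n + 1)))) y v) = _ from
    funext fun y => fderiv_coe_chartAt_symm x y v]
  refine (congrArg (fun L => L v) h3.fderiv).trans ?_
  simp [smul_smul]
  norm_num

/-- The Laplacian of the restriction to the sphere of a function of the ambient space. -/
theorem sphereLaplacian_restrict {G : EuclideanSpace ℝ (Fin (n + 1)) → ℝ} {φ : Sph n → ℝ}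
    (x : Sph n) (hG : ContDiffAt ℝ 2 G x) (hφ : ∀ z : Sph n, φ z = G z) :
    sphereLaplacian φ x = ambientLaplacian G x
      - fderiv ℝ (fderiv ℝ G) x x x - n * fderiv ℝ G x x := by
  set γ : EuclideanSpace ℝ (Fin n) → EuclideanSpace ℝ (Fin (n + 1)) :=
    fun z => (((chartAt (EuclideanSpace ℝ (Fin n)) x).symm z : Sph n) :
      EuclideanSpace ℝ (Fin (n + 1))) with hγ
  have hγs : ContDiff ℝ ∞ γ := contDiff_coe_chartAt_symm x
  have hγd : Differentiable ℝ γ := hγs.differentiable (by simp)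
  have hγ0 : γ 0 = x := by rw [hγ]; simp only; rw [chartAt_symm_zero]
  have hγ1 : ∀ v, fderiv ℝ γ 0 v = chartFrame x v := fun v => by
    rw [hγ, fderiv_coe_chartAt_symm]; simp
  have hGd : ∀ᶠ z in nhds (x : EuclideanSpace ℝ (Fin (n + 1))), DifferentiableAt ℝ G z := by
    have h := (hG.of_le (m := 1) (by norm_num)).eventually (by simp)
    exact h.mono fun z hz => hz.differentiableAt (by simp)
  have hDG : DifferentiableAt ℝ (fderiv ℝ G) (γ 0) := by
    rw [hγ0]
    exact (hG.fderiv_right (m := 1) (by norm_num)).differentiableAt (by simp)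
  have hGd' : ∀ᶠ y in nhds (0 : EuclideanSpace ℝ (Fin n)), DifferentiableAt ℝ G (γ y) := by
    refine hγs.continuous.continuousAt.eventually ?_
    rwa [hγ0]
  -- Second derivative of `G ∘ γ`: the Hessian of `G` on the frame vector, plus the gradient of `G`
  -- on the acceleration -x. Summed over the frame, the latter gives the term -n ∂G/∂x.
  have hterm : ∀ i, partialD i (partialD i fun y =>
      φ ((chartAt (EuclideanSpace ℝ (Fin n)) x).symm y)) 0
      = fderiv ℝ (fderiv ℝ G) x (chartFrame x (EuclideanSpace.single i 1))
        (chartFrame x (EuclideanSpace.single i 1)) - fderiv ℝ G x x := by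
    intro i
    have e1 : (partialD i fun y => φ ((chartAt (EuclideanSpace ℝ (Fin n)) x).symm y))
        =ᶠ[nhds 0] fun y => fderiv ℝ G (γ y) (fderiv ℝ γ y (EuclideanSpace.single i 1)) := by
      refine hGd'.mono fun y hy => ?_
      have : (fun y => φ ((chartAt (EuclideanSpace ℝ (Fin n)) x).symm y)) = G ∘ γ :=
        funext fun y => hφ _
      rw [partialD, this, fderiv_comp y hy (hγd y)]
      rfl
    have hV : DifferentiableAt ℝ (fun y => fderiv ℝ γ y (EuclideanSpace.single i 1)) 0 :=
      ((hγs.fderiv_right (m := ∞) (by simp)).clm_apply contDiff_const).differentiable (by simp) 0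
    have hDGγ : HasFDerivAt (fun y => fderiv ℝ G (γ y))
        (fderiv ℝ (fderiv ℝ G) (γ 0) ∘L fderiv ℝ γ 0) 0 :=
      HasFDerivAt.comp 0 hDG.hasFDerivAt (hγd 0).hasFDerivAt
    have h3 := hDGγ.clm_apply hV.hasFDerivAt
    have h4 := e1.fderiv_eq (𝕜 := ℝ)
    rw [partialD, h4]
    refine (congrArg (fun L : EuclideanSpace ℝ (Fin n) →L[ℝ] ℝ => L (EuclideanSpace.single i 1))
      h3.fderiv).trans ?_
    have h5 := hasFDerivAt_fderiv_coe_chartAt_symm x (EuclideanSpace.single i 1)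
    simp only [add_apply, ContinuousLinearMap.comp_apply,
      ContinuousLinearMap.flip_apply, hγ0, hγ1]
    rw [h5]
    simp
    ring
  rw [sphereLaplacian, flatLaplacian]
  simp only [hterm, Finset.sum_sub_distrib, Finset.sum_const, Finset.card_univ, Fintype.card_fin,
    nsmul_eq_mul]
  rw [ambientLaplacian_eq_chartFrame G x]
  ring

/-- The extension of a function on the sphere that is constant along rays. -/
def radialExt (φ : Sph n → ℝ) (z : EuclideanSpace ℝ (Fin (n + 1))) : ℝ :=
  if h : z = 0 then 0 else φ ⟨‖z‖⁻¹ • z, by simp [norm_smul, h]⟩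

theorem radialExt_coe (φ : Sph n → ℝ) (x : Sph n) : radialExt φ x = φ x := by
  have h : (x : EuclideanSpace ℝ (Fin (n + 1))) ≠ 0 := ne_zero_of_mem_unit_sphere x
  simp only [radialExt, dif_neg h]
  congr 1
  apply Subtype.ext
  simp

theorem radialExt_smul (φ : Sph n → ℝ) {r : ℝ} (hr : 0 < r)
    (z : EuclideanSpace ℝ (Fin (n + 1))) : radialExt φ (r • z) = radialExt φ z := by
  by_cases h : z = 0
  · simp [h]
  · have h' : r • z ≠ 0 := smul_ne_zero hr.ne' h
    simp only [radialExt, dif_neg h, dif_neg h']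
    congr 1
    apply Subtype.ext
    simp only [norm_smul, Real.norm_of_nonneg hr.le, smul_smul]
    congr 1
    have := norm_ne_zero_iff.2 h
    field_simp

/-- Near `z` the extension is φ read in the chart at p = z / ‖z‖, after normalisation and
stereographic projection from `-p`; smoothness holds as long as the normalised point avoids `-p`. -/
theorem contDiffAt_radialExt (φ : SmoothFun n (Sph n)) {z : EuclideanSpace ℝ (Fin (n + 1))}
    (hz : z ≠ 0) : ContDiffAt ℝ ∞ (radialExt φ) z := by
  have := Fact.mk (@finrank_euclideanSpace_fin ℝ _ (n + 1))
  set p : Sph n := ⟨‖z‖⁻¹ • z, by simp [norm_smul, hz]⟩ with hp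
  set U := (OrthonormalBasis.fromOrthogonalSpanSingleton (𝕜 := ℝ) n
      (ne_zero_of_mem_unit_sphere (-p))).repr
  have hN : ContDiffAt ℝ ∞ (fun w : EuclideanSpace ℝ (Fin (n + 1)) => ‖w‖⁻¹ • w) z :=
    ((contDiffAt_id.norm ℝ hz).inv (norm_ne_zero_iff.2 hz)).smul contDiffAt_id
  have hin : innerSL ℝ ((-p : Sph n) : EuclideanSpace ℝ (Fin (n + 1))) (‖z‖⁻¹ • z) < 1 := by
    change ⟪((-p : Sph n) : EuclideanSpace ℝ (Fin (n + 1))), (p : EuclideanSpace ℝ (Fin (n + 1)))⟫_ℝ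
      < 1
    rw [coe_neg_sphere, inner_neg_left, real_inner_self_eq_norm_sq]
    simp
  have hopen : IsOpen {w | innerSL ℝ ((-p : Sph n) : EuclideanSpace ℝ (Fin (n + 1))) w ≠ (1 : ℝ)} :=
    isOpen_ne_fun (by fun_prop) continuous_const
  have hS : ContDiffAt ℝ ∞ (stereoToFun ((-p : Sph n) : EuclideanSpace ℝ (Fin (n + 1))))
      (‖z‖⁻¹ • z) :=
    contDiffOn_stereoToFun.contDiffAt (hopen.mem_nhds hin.ne)
  have hcomp : ContDiffAt ℝ ∞ (fun w => φ ((chartAt (EuclideanSpace ℝ (Fin n)) p).symm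
      (U (stereoToFun ((-p : Sph n) : EuclideanSpace ℝ (Fin (n + 1))) (‖w‖⁻¹ • w))))) z :=
    (contDiff_comp_chartAt_symm φ p).contDiffAt.comp z
      (U.contDiff.contDiffAt.comp z (hS.comp (f := fun w => ‖w‖⁻¹ • w) z hN))
  refine hcomp.congr_of_eventuallyEq ?_
  have hev : ∀ᶠ w in nhds z, innerSL ℝ ((-p : Sph n) : EuclideanSpace ℝ (Fin (n + 1)))
      (‖w‖⁻¹ • w) < 1 := by
    have hc := ((innerSL ℝ ((-p : Sph n) : EuclideanSpace ℝ (Fin (n + 1)))).continuous.continuousAt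
      (x := ‖z‖⁻¹ • z)).comp_of_eq hN.continuousAt rfl
    exact hc.eventually_lt continuousAt_const hin
  filter_upwards [hev, isOpen_ne.mem_nhds hz] with w hw hw0
  have hw0' : w ≠ 0 := hw0
  simp only [radialExt, dif_neg hw0']
  set q : Sph n := ⟨‖w‖⁻¹ • w, by simp [norm_smul, hw0']⟩ with hq
  have hqs : q ∈ (chartAt (EuclideanSpace ℝ (Fin n)) p).source := by
    change q ∈ (stereographic' n (-p)).source
    rw [stereographic'_source]
    intro h
    have h' : q = -p := h
    have h1 : innerSL ℝ ((-p : Sph n) : EuclideanSpace ℝ (Fin (n + 1)))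
        (q : EuclideanSpace ℝ (Fin (n + 1))) < 1 := hw
    rw [h', innerSL_apply_apply, real_inner_self_eq_norm_sq] at h1
    simp at h1
  exact congrArg φ ((chartAt (EuclideanSpace ℝ (Fin n)) p).left_inv hqs).symm

theorem fderiv_radialExt_self (φ : SmoothFun n (Sph n)) {z : EuclideanSpace ℝ (Fin (n + 1))}
    (hz : z ≠ 0) : fderiv ℝ (radialExt φ) z z = 0 := by
  have hd : HasFDerivAt (radialExt φ) (fderiv ℝ (radialExt φ) z) ((1 : ℝ) • z) := by
    rw [one_smul]
    exact ((contDiffAt_radialExt φ hz).differentiableAt (by simp)).hasFDerivAt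
  have h1 : HasDerivAt (fun r : ℝ => r • z) z 1 := by
    simpa using (hasDerivAt_id (1 : ℝ)).smul_const z
  have h2 := hd.comp_hasDerivAt 1 h1
  have h3 : (radialExt φ ∘ fun r : ℝ => r • z) =ᶠ[nhds 1] fun _ => radialExt φ z := by
    filter_upwards [isOpen_Ioi.mem_nhds (show (0 : ℝ) < 1 by norm_num)] with r hr
    exact radialExt_smul φ hr z
  rw [← h2.deriv, h3.deriv_eq, deriv_const]

theorem differentiableAt_fderiv_radialExt (φ : SmoothFun n (Sph n))
    {z : EuclideanSpace ℝ (Fin (n + 1))} (hz : z ≠ 0) :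
    DifferentiableAt ℝ (fderiv ℝ (radialExt φ)) z :=
  ((contDiffAt_radialExt φ hz).fderiv_right (m := 1) (by norm_cast)).differentiableAt (by simp)

/-- Differentiate the identity DU(w) w = 0 at `z` in the direction `z`; the extra term DU(z) z is
again zero. -/
theorem fderiv_fderiv_radialExt_self (φ : SmoothFun n (Sph n))
    {z : EuclideanSpace ℝ (Fin (n + 1))} (hz : z ≠ 0) :
    fderiv ℝ (fderiv ℝ (radialExt φ)) z z z = 0 := by
  have hd := (differentiableAt_fderiv_radialExt φ hz).hasFDerivAt.clm_apply (hasFDerivAt_id z)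
  have h3 : (fun w => fderiv ℝ (radialExt φ) w (id w)) =ᶠ[nhds z] fun _ => 0 := by
    filter_upwards [isOpen_ne.mem_nhds hz] with w hw
    exact fderiv_radialExt_self φ hw
  have h4 := congrArg (fun L => L z) (hd.fderiv.symm.trans h3.fderiv_eq)
  simpa [fderiv_radialExt_self φ hz] using h4

/-- Both radial corrections vanish for an extension constant along rays. This removes the
point-dependent charts from the Laplacian, which gives its continuity and its symmetry. -/
theorem sphereLaplacian_eq_radialExt (φ : SmoothFun n (Sph n)) (x : Sph n) :
    sphereLaplacian φ x = ambientLaplacian (radialExt φ) x := by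
  have hx : (x : EuclideanSpace ℝ (Fin (n + 1))) ≠ 0 := ne_zero_of_mem_unit_sphere x
  rw [sphereLaplacian_restrict (G := radialExt φ) x ((contDiffAt_radialExt φ hx).of_le (by norm_cast))
    fun z => (radialExt_coe φ z).symm, fderiv_radialExt_self φ hx,
    fderiv_fderiv_radialExt_self φ hx]
  ring

theorem continuousOn_ambientLaplacian_radialExt (φ : SmoothFun n (Sph n)) :
    ContinuousOn (ambientLaplacian (radialExt φ)) {0}ᶜ := by
  intro z hz
  have h : ContDiffAt ℝ ∞ (fderiv ℝ (fderiv ℝ (radialExt φ))) z :=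
    ((contDiffAt_radialExt φ hz).fderiv_right (m := ∞) (by simp)).fderiv_right (m := ∞) (by simp)
  refine ContinuousAt.continuousWithinAt ?_
  refine tendsto_finsetSum _ fun i _ => ?_
  exact ((h.continuousAt.clm_apply continuousAt_const).clm_apply continuousAt_const)

theorem continuous_sphereLaplacian (φ : SmoothFun n (Sph n)) : Continuous (sphereLaplacian φ) := by
  rw [show sphereLaplacian φ = fun x : Sph n => ambientLaplacian (radialExt φ) x from
    funext fun x => sphereLaplacian_eq_radialExt φ x]
  exact (continuousOn_ambientLaplacian_radialExt φ).comp_continuous continuous_subtype_val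
    fun x => ne_zero_of_mem_unit_sphere x

theorem continuous_sphereBox (φ : SmoothFun n (Sph n)) : Continuous (sphereBox φ) :=
  (continuous_sphereLaplacian φ).neg.add (continuous_const.mul φ.contMDiff.continuous)

/-- The Laplacian of the power of a linear form. -/
theorem sphereLaplacian_inner_pow (a : EuclideanSpace ℝ (Fin (n + 1))) (k : ℕ) (x : Sph n) :
    sphereLaplacian (fun z : Sph n => ⟪a, z⟫_ℝ ^ k) x =
      -((k : ℝ) * (k + n - 1)) * ⟪a, x⟫_ℝ ^ k
        + (k : ℝ) * (k - 1) * ‖a‖ ^ 2 * ⟪a, x⟫_ℝ ^ (k - 2) := by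
  set G : EuclideanSpace ℝ (Fin (n + 1)) → ℝ := fun z => ⟪a, z⟫_ℝ ^ k with hG
  have hGs : ContDiff ℝ 2 G := (innerSL ℝ a : _ →L[ℝ] ℝ).contDiff.pow k
  have hlin : ∀ z, HasFDerivAt (fun z => ⟪a, z⟫_ℝ) (innerSL ℝ a) z := fun z =>
    (innerSL ℝ a : EuclideanSpace ℝ (Fin (n + 1)) →L[ℝ] ℝ).hasFDerivAt
  have h1 : fderiv ℝ G = fun z => ((k : ℝ) * ⟪a, z⟫_ℝ ^ (k - 1)) • innerSL ℝ a := by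
    funext z
    have := ((hasDerivAt_pow k ⟪a, z⟫_ℝ).comp_hasFDerivAt z (hlin z)).fderiv
    exact this
  have h2 : ∀ z u v, fderiv ℝ (fderiv ℝ G) z u v
      = (k : ℝ) * (k - 1) * ⟪a, z⟫_ℝ ^ (k - 2) * (⟪a, u⟫_ℝ * ⟪a, v⟫_ℝ) := by
    intro z u v
    have h := ((((hasDerivAt_pow (k - 1) ⟪a, z⟫_ℝ).comp_hasFDerivAt z (hlin z)).const_mul (k : ℝ)).smul_const (innerSL ℝ a)).fderiv
    rw [h1]
    refine (congrArg (fun L => L u v) h).trans ?_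
    rcases k with _ | k
    · simp
    · simp [show k + 1 - 2 = k - 1 by omega]
      ring
  have hs := sphereLaplacian_restrict (φ := fun z : Sph n => ⟪a, z⟫_ℝ ^ k) x hGs.contDiffAt
    fun z => rfl
  rw [hs, ambientLaplacian]
  simp only [h2, ← Finset.mul_sum]
  simp only [h1]
  have h3 : ∑ i, ⟪a, EuclideanSpace.single i (1 : ℝ)⟫_ℝ * ⟪a, EuclideanSpace.single i (1 : ℝ)⟫_ℝ
      = ‖a‖ ^ 2 := by
    rw [EuclideanSpace.norm_sq_eq]
    refine Finset.sum_congr rfl fun i _ => ?_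
    rw [EuclideanSpace.inner_single_right]
    simp [sq]
  rw [h3]
  -- For k = 0 and k = 1 the truncated exponent k - 2 is 0, but the coefficient k (k - 1) vanishes.
  rcases k with _ | _ | k
  · simp
  · simp
  · simp
    ring

end Ambient

/-! ### Symmetry of the Laplacian of the sphere -/

section Symmetry

variable {n : ℕ}

/-- The surface measure of the sphere. -/
abbrev sphereMeasure (n : ℕ) : Measure (Sph n) :=
  (volume : Measure (EuclideanSpace ℝ (Fin (n + 1)))).toSphere

/-- Integration in polar coordinates of a function that is a product of a radial function and
a function that is homogeneous of degree `-2`. -/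
theorem exists_integral_eq_mul_integral_sphere (χ : ℝ → ℝ) :
    ∃ c : ℝ, ∀ h : EuclideanSpace ℝ (Fin (n + 1)) → ℝ,
      (∀ r : ℝ, 0 < r → ∀ x : Sph n, h (r • (x : EuclideanSpace ℝ (Fin (n + 1)))) =
        (r ^ 2)⁻¹ * h x) →
      ∫ z, χ (‖z‖ ^ 2) * h z = c * ∫ x : Sph n, h x ∂sphereMeasure n := by
  set E := EuclideanSpace ℝ (Fin (n + 1))
  set ν := Measure.volumeIoiPow (finrank ℝ E - 1)
  -- The constant is the radial integral of χ(r²) r⁻² against rⁿ dr. It does not depend on `h`;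
  -- later only its being nonzero matters.
  refine ⟨∫ r : Ioi (0 : ℝ), χ (r.1 ^ 2) * (r.1 ^ 2)⁻¹ ∂ν, fun h hh => ?_⟩
  set μ : Measure E := volume
  have h1 := (μ.measurePreserving_homeomorphUnitSphereProd).integral_comp
    (Homeomorph.measurableEmbedding _)
    (fun p : sphere (0 : E) 1 × Ioi (0 : ℝ) => h p.1 * (χ (p.2.1 ^ 2) * (p.2.1 ^ 2)⁻¹))
  have h2 := integral_prod_mul (μ := μ.toSphere) (ν := ν) (fun x : sphere (0 : E) 1 => h x)
    (fun r : Ioi (0 : ℝ) => χ (r.1 ^ 2) * (r.1 ^ 2)⁻¹)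
  have h3 : ∫ z : ({(0 : E)}ᶜ : Set E), χ (‖(z : E)‖ ^ 2) * h z ∂(μ.comap (↑))
      = ∫ z, χ (‖z‖ ^ 2) * h z ∂μ := by
    rw [integral_subtype_comap (measurableSet_singleton _).compl fun z : E => χ (‖z‖ ^ 2) * h z,
      restrict_compl_singleton]
  rw [← h3, mul_comm]
  refine Eq.trans ?_ (h1.trans h2)
  refine integral_congr_ae (Filter.Eventually.of_forall fun z => ?_)
  have hz : (z : E) ≠ 0 := z.2
  have hz' : 0 < ‖(z : E)‖ := norm_pos_iff.2 hz
  set p := homeomorphUnitSphereProd E z with hp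
  have e1 : (p.1 : E) = ‖(z : E)‖⁻¹ • (z : E) := homeomorphUnitSphereProd_apply_fst_coe E z
  have e2 : (p.2 : ℝ) = ‖(z : E)‖ := homeomorphUnitSphereProd_apply_snd_coe E z
  have e3 := hh ‖(z : E)‖ hz' p.1
  rw [e1, smul_smul, mul_inv_cancel₀ hz'.ne', one_smul] at e3
  change χ (‖(z : E)‖ ^ 2) * h z = h p.1 * (χ ((p.2 : ℝ) ^ 2) * ((p.2 : ℝ) ^ 2)⁻¹)
  rw [e1, e2, e3]
  ring

theorem fderiv_radialExt_smul (φ : Sph n → ℝ) {r : ℝ} (hr : 0 < r)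
    (z : EuclideanSpace ℝ (Fin (n + 1))) :
    fderiv ℝ (radialExt φ) (r • z) = r⁻¹ • fderiv ℝ (radialExt φ) z := by
  have h := fderiv_comp_smul (f := radialExt φ) (x := z) r
  simp only [radialExt_smul φ hr] at h
  rw [h, smul_smul, inv_mul_cancel₀ hr.ne', one_smul]

theorem fderiv_fderiv_radialExt_smul (φ : Sph n → ℝ) {r : ℝ} (hr : 0 < r)
    (z : EuclideanSpace ℝ (Fin (n + 1))) :
    fderiv ℝ (fderiv ℝ (radialExt φ)) (r • z) =
      (r ^ 2)⁻¹ • fderiv ℝ (fderiv ℝ (radialExt φ)) z := by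
  have h := fderiv_comp_smul (f := fderiv ℝ (radialExt φ)) (x := z) r
  have h2 : (fun z => fderiv ℝ (radialExt φ) (r • z)) = r⁻¹ • fderiv ℝ (radialExt φ) :=
    funext fun z => fderiv_radialExt_smul φ hr z
  rw [h2, fderiv_const_smul_field (f := fderiv ℝ (radialExt φ)) r⁻¹, Pi.smul_apply] at h
  have h3 := congrArg (fun L => r⁻¹ • L) h
  simp only [smul_smul] at h3
  rw [inv_mul_cancel₀ hr.ne', one_smul] at h3
  rw [← h3]
  congr 1
  field_simp

theorem ambientLaplacian_radialExt_smul (φ : Sph n → ℝ) {r : ℝ} (hr : 0 < r)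
    (z : EuclideanSpace ℝ (Fin (n + 1))) :
    ambientLaplacian (radialExt φ) (r • z) = (r ^ 2)⁻¹ * ambientLaplacian (radialExt φ) z := by
  simp [ambientLaplacian, fderiv_fderiv_radialExt_smul φ hr, Finset.mul_sum]

/-- Continuity needs checking only on the support of the product, so singularities of `h` off `s`,
such as that of a radial extension at 0, do no harm. -/
theorem continuous_mul_of_tsupport_subset {η h : EuclideanSpace ℝ (Fin n) → ℝ}
    (hη : Continuous η) {s : Set (EuclideanSpace ℝ (Fin n))}
    (hs : IsOpen s) (hsub : tsupport η ⊆ s) (hh : ContinuousOn h s) :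
    Continuous fun z => η z * h z := by
  refine continuous_of_tsupport fun z hz => ?_
  have hz' : z ∈ s := hsub (tsupport_mul_subset_left hz)
  exact hη.continuousAt.mul (hh.continuousAt (hs.mem_nhds hz'))

theorem integrable_mul_of_tsupport_subset {η h : EuclideanSpace ℝ (Fin n) → ℝ}
    (hη : Continuous η) (hc : HasCompactSupport η) {s : Set (EuclideanSpace ℝ (Fin n))}
    (hs : IsOpen s) (hsub : tsupport η ⊆ s) (hh : ContinuousOn h s) :
    Integrable fun z => η z * h z :=
  (continuous_mul_of_tsupport_subset hη hs hsub hh).integrable_of_hasCompactSupport hc.mul_right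

theorem tsupport_comp_norm_sq_subset {χ : ℝ → ℝ} (hχ0 : (0 : ℝ) ∉ tsupport χ) :
    tsupport (fun z : EuclideanSpace ℝ (Fin n) => χ (‖z‖ ^ 2)) ⊆ {0}ᶜ := by
  intro z hz h
  have h0 : z = 0 := h
  have h2 := tsupport_comp_subset_preimage (f := fun z : EuclideanSpace ℝ (Fin n) => ‖z‖ ^ 2) χ
    (by fun_prop) hz
  rw [h0] at h2
  simp [hχ0] at h2

theorem hasCompactSupport_comp_norm_sq {χ : ℝ → ℝ} (hχ : HasCompactSupport χ) :
    HasCompactSupport fun z : EuclideanSpace ℝ (Fin n) => χ (‖z‖ ^ 2) := by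
  obtain ⟨R, hR⟩ := hχ.isCompact.isBounded.subset_closedBall 0
  refine HasCompactSupport.of_support_subset_isCompact
    (isCompact_closedBall (0 : EuclideanSpace ℝ (Fin n)) (R + 1)) fun z hz => ?_
  have h1 := hR (subset_tsupport χ hz)
  rw [mem_closedBall_zero_iff, Real.norm_eq_abs] at h1
  rw [mem_closedBall_zero_iff]
  nlinarith [sq_nonneg (‖z‖ - 1), le_abs_self (‖z‖ ^ 2)]

theorem inner_single_one (z : EuclideanSpace ℝ (Fin n)) (i : Fin n) :
    ⟪z, EuclideanSpace.single i (1 : ℝ)⟫_ℝ = z i := by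
  simp [EuclideanSpace.inner_single_right]

/-- Green's identity in the ambient space, for functions that are constant along rays and a
radial cut-off. -/
theorem integral_cutoff_mul_laplacian_sub {χ : ℝ → ℝ} (hχ : ContDiff ℝ ∞ χ)
    (hχc : HasCompactSupport χ) (hχ0 : (0 : ℝ) ∉ tsupport χ) (φ ψ : SmoothFun n (Sph n)) :
    ∫ z : EuclideanSpace ℝ (Fin (n + 1)), χ (‖z‖ ^ 2) *
      (radialExt φ z * ambientLaplacian (radialExt ψ) z
        - radialExt ψ z * ambientLaplacian (radialExt φ) z) = 0 := by
  set E := EuclideanSpace ℝ (Fin (n + 1))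
  set η : E → ℝ := fun z => χ (‖z‖ ^ 2) with hη
  have hηs : ContDiff ℝ ∞ η := hχ.comp (contDiff_norm_sq ℝ)
  have hsub : tsupport η ⊆ ({0}ᶜ : Set E) := tsupport_comp_norm_sq_subset hχ0
  have hηc : HasCompactSupport η := hasCompactSupport_comp_norm_sq hχc
  have hopen : IsOpen ({0}ᶜ : Set E) := isOpen_compl_singleton
  have hU : ∀ φ : SmoothFun n (Sph n), ContinuousOn (radialExt φ) {0}ᶜ := fun φ z hz =>
    (contDiffAt_radialExt φ hz).continuousAt.continuousWithinAt
  have hDU : ∀ φ : SmoothFun n (Sph n), ∀ v, ContinuousOn (fun z => fderiv ℝ (radialExt φ) z v)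
      {0}ᶜ := fun φ v z hz =>
    ((differentiableAt_fderiv_radialExt φ hz).continuousAt.clm_apply
      continuousAt_const).continuousWithinAt
  set b : Fin (n + 1) → E := fun i => EuclideanSpace.single i 1 with hb
  -- The components of U ∇V - V ∇U for the two extensions U and V; the divergence is U ΔV - V ΔU,
  -- because the gradient products cancel.
  set g : Fin (n + 1) → E → ℝ := fun i z => radialExt φ z * fderiv ℝ (radialExt ψ) z (b i)
    - radialExt ψ z * fderiv ℝ (radialExt φ) z (b i) with hg
  have hgc : ∀ i, ContinuousOn (g i) {0}ᶜ := fun i =>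
    ((hU φ).mul (hDU ψ _)).sub ((hU ψ).mul (hDU φ _))
  have hgd : ∀ i, ∀ z ∈ ({0}ᶜ : Set E), HasFDerivAt (g i) (fderiv ℝ (g i) z) z ∧
      fderiv ℝ (g i) z (b i) = radialExt φ z * fderiv ℝ (fderiv ℝ (radialExt ψ)) z (b i) (b i)
        - radialExt ψ z * fderiv ℝ (fderiv ℝ (radialExt φ)) z (b i) (b i) := by
    intro i z hz
    have hd : ∀ φ : SmoothFun n (Sph n), HasFDerivAt (radialExt φ) (fderiv ℝ (radialExt φ) z) z :=
      fun φ => ((contDiffAt_radialExt φ hz).differentiableAt (by simp)).hasFDerivAt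
    have hdd : ∀ φ : SmoothFun n (Sph n), HasFDerivAt (fun z => fderiv ℝ (radialExt φ) z (b i))
        _ z := fun φ =>
      (differentiableAt_fderiv_radialExt φ hz).hasFDerivAt.clm_apply (hasFDerivAt_const (b i) z)
    have h := ((hd φ).fun_mul (hdd ψ)).fun_sub ((hd ψ).fun_mul (hdd φ))
    have h' : HasFDerivAt (g i) _ z := h
    refine ⟨h'.differentiableAt.hasFDerivAt, ?_⟩
    rw [h'.fderiv]
    simp
    ring
  have hint1 : ∀ i, Integrable fun z => η z * fderiv ℝ (g i) z (b i) := by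
    intro i
    refine integrable_mul_of_tsupport_subset hηs.continuous hηc hopen hsub ?_
    refine ContinuousOn.congr (f := fun z =>
      radialExt φ z * fderiv ℝ (fderiv ℝ (radialExt ψ)) z (b i) (b i)
      - radialExt ψ z * fderiv ℝ (fderiv ℝ (radialExt φ)) z (b i) (b i)) ?_
      fun z hz => (hgd i z hz).2
    have hc : ∀ φ : SmoothFun n (Sph n), ContinuousOn
        (fun z => fderiv ℝ (fderiv ℝ (radialExt φ)) z (b i) (b i)) {0}ᶜ := by
      intro φ z hz
      have h : ContDiffAt ℝ ∞ (fderiv ℝ (fderiv ℝ (radialExt φ))) z :=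
        ((contDiffAt_radialExt φ hz).fderiv_right (m := ∞) (by simp)).fderiv_right
          (m := ∞) (by simp)
      exact ((h.continuousAt.clm_apply continuousAt_const).clm_apply
        continuousAt_const).continuousWithinAt
    exact ((hU φ).mul (hc ψ)).sub ((hU ψ).mul (hc φ))
  have hint2 : ∀ i, Integrable fun z => fderiv ℝ η z (b i) * g i z := by
    intro i
    refine integrable_mul_of_tsupport_subset
      ((hηs.continuous_fderiv (by simp)).clm_apply continuous_const) (hηc.fderiv_apply ℝ _)
      hopen ?_ (hgc i)
    exact (tsupport_fderiv_apply_subset ℝ _).trans hsub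
  have hparts : ∀ i, ∫ z, η z * fderiv ℝ (g i) z (b i) = -∫ z, fderiv ℝ η z (b i) * g i z :=
    fun i => integral_mul_fderiv_eq_neg_fderiv_mul_of_integrable (hint2 i) (hint1 i)
      (integrable_mul_of_tsupport_subset hηs.continuous hηc hopen hsub (hgc i))
      (fun z _ => hηs.differentiable (by simp) z)
      fun z hz => (hgd i z (hsub hz)).1.differentiableAt
  have hsum1 : ∀ z, η z * (radialExt φ z * ambientLaplacian (radialExt ψ) z
        - radialExt ψ z * ambientLaplacian (radialExt φ) z)
      = ∑ i, η z * fderiv ℝ (g i) z (b i) := by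
    intro z
    by_cases hz : z = 0
    · have : η z = 0 := by
        by_contra h
        exact hsub (subset_tsupport _ h) hz
      simp [this]
    · simp only [(hgd _ z hz).2, ambientLaplacian, Finset.mul_sum, mul_sub,
        Finset.sum_sub_distrib]
      rfl
  -- After integration by parts the cut-off contributes ∇η · (U ∇V - V ∇U). This vanishes because ∇η
  -- is radial and the radial derivatives of U and V are zero.
  have hsum2 : ∀ z, ∑ i, fderiv ℝ η z (b i) * g i z = 0 := by
    intro z
    by_cases hz : z = 0
    · have : fderiv ℝ η z = 0 := by
        by_contra h
        exact hsub (tsupport_fderiv_subset ℝ (subset_tsupport _ h)) hz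
      simp [this]
    · have hf : ∀ i, fderiv ℝ η z (b i) = 2 * deriv χ (‖z‖ ^ 2) * z i := by
        intro i
        have h1 := ((hχ.differentiable (by simp) (‖z‖ ^ 2)).hasDerivAt).comp_hasFDerivAt z
          (hasStrictFDerivAt_norm_sq z).hasFDerivAt
        have h2 : HasFDerivAt η _ z := h1
        have h3 : ⟪z, b i⟫_ℝ = z i := inner_single_one z i
        rw [h2.fderiv]
        simp [h3]
        ring
      have hD : ∀ φ : SmoothFun n (Sph n), ∑ i, z i * fderiv ℝ (radialExt φ) z (b i) = 0 := by
        intro φ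
        rw [← fderiv_radialExt_self φ hz]
        have : z = ∑ i, z i • b i := by
          have := (EuclideanSpace.basisFun (Fin (n + 1)) ℝ).sum_repr z
          simpa [hb] using this.symm
        conv_rhs => rw [show fderiv ℝ (radialExt φ) z z
          = fderiv ℝ (radialExt φ) z (∑ i, z i • b i) from congrArg _ this]
        simp
      have : ∀ i, fderiv ℝ η z (b i) * g i z = 2 * deriv χ (‖z‖ ^ 2) * radialExt φ z
          * (z i * fderiv ℝ (radialExt ψ) z (b i))
          - 2 * deriv χ (‖z‖ ^ 2) * radialExt ψ z * (z i * fderiv ℝ (radialExt φ) z (b i)) := by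
        intro i
        rw [hf, hg]
        ring
      simp only [this, Finset.sum_sub_distrib, ← Finset.mul_sum, hD]
      ring
  rw [integral_congr_ae (Filter.Eventually.of_forall hsum1), integral_finsetSum _ fun i _ => hint1 i]
  simp only [hparts]
  rw [Finset.sum_neg_distrib, ← integral_finsetSum _ fun i _ => hint2 i]
  simp [hsum2]

/-- For the ray-constant extensions U and V, U ΔV - V ΔU is homogeneous of degree -2, so its
integral against a radial cut-off is a constant times its integral over the sphere. The former
vanishes by Green's identity, and the constant is not zero. -/
theorem integral_mul_sphereLaplacian_comm (φ ψ : SmoothFun n (Sph n)) :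
    ∫ x, φ x * sphereLaplacian ψ x ∂sphereMeasure n =
      ∫ x, ψ x * sphereLaplacian φ x ∂sphereMeasure n := by
  set E := EuclideanSpace ℝ (Fin (n + 1))
  let χ : ContDiffBump (1 : ℝ) := ⟨1 / 4, 1 / 2, by norm_num, by norm_num⟩
  have hχ0 : (0 : ℝ) ∉ tsupport χ := by
    rw [χ.tsupport_eq]
    simp [χ]
    norm_num
  obtain ⟨c, hc⟩ := exists_integral_eq_mul_integral_sphere (n := n) χ
  have h1 := hc (fun z => radialExt φ z * ambientLaplacian (radialExt ψ) z
        - radialExt ψ z * ambientLaplacian (radialExt φ) z) fun r hr x => by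
    rw [radialExt_smul _ hr, radialExt_smul _ hr, ambientLaplacian_radialExt_smul _ hr,
      ambientLaplacian_radialExt_smul _ hr]
    ring
  rw [integral_cutoff_mul_laplacian_sub χ.contDiff χ.hasCompactSupport hχ0] at h1
  -- The same constant tested on ‖z‖⁻², where the integral is visibly positive; hence c ≠ 0.
  have h2 := hc (fun z => (‖z‖ ^ 2)⁻¹) fun r hr x => by
    simp [norm_smul]
  have hpos : 0 < ∫ z : E, χ (‖z‖ ^ 2) * (‖z‖ ^ 2)⁻¹ := by
    refine Continuous.integral_pos_of_hasCompactSupport_nonneg_nonzero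
      (x := (EuclideanSpace.single 0 1 : E)) ?_ ?_ ?_ ?_
    · refine continuous_mul_of_tsupport_subset
        (χ.continuous.comp (continuous_norm.pow 2)) isOpen_compl_singleton
        (tsupport_comp_norm_sq_subset hχ0) ?_
      exact (continuous_norm.pow 2).continuousOn.inv₀ fun z hz =>
        pow_ne_zero 2 (norm_ne_zero_iff.2 hz)
    · exact (hasCompactSupport_comp_norm_sq χ.hasCompactSupport).mul_right
    · exact fun z => mul_nonneg χ.nonneg (by positivity)
    · have h4 : χ (1 : ℝ) = 1 := χ.one_of_mem_closedBall (mem_closedBall_self χ.rIn_pos.le)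
      have h5 : ‖(EuclideanSpace.single 0 1 : EuclideanSpace ℝ (Fin (n + 1)))‖ = 1 := by simp
      have h6 : χ (‖(EuclideanSpace.single 0 1 : EuclideanSpace ℝ (Fin (n + 1)))‖ ^ 2)
        * (‖(EuclideanSpace.single 0 1 : EuclideanSpace ℝ (Fin (n + 1)))‖ ^ 2)⁻¹ ≠ 0 := by
        rw [h5, one_pow, h4]
        norm_num
      exact h6
  have hc0 : c ≠ 0 := by
    rintro rfl
    rw [h2] at hpos
    simp at hpos
  have h3 := (mul_eq_zero.1 h1.symm).resolve_left hc0
  have hci : ∀ φ ψ : SmoothFun n (Sph n), Integrable (fun x => φ x * sphereLaplacian ψ x)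
      (sphereMeasure n) := fun φ ψ =>
    (φ.contMDiff.continuous.mul (continuous_sphereLaplacian ψ)).integrable_of_hasCompactSupport
      (HasCompactSupport.of_compactSpace _)
  rw [← sub_eq_zero, ← integral_sub (hci φ ψ) (hci ψ φ), ← h3]
  refine integral_congr_ae (Filter.Eventually.of_forall fun x => ?_)
  simp only [radialExt_coe, sphereLaplacian_eq_radialExt]

theorem integral_mul_sphereBox_comm (φ ψ : SmoothFun n (Sph n)) :
    ∫ x, φ x * sphereBox ψ x ∂sphereMeasure n = ∫ x, ψ x * sphereBox φ x ∂sphereMeasure n := by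
  have hci : ∀ φ ψ : SmoothFun n (Sph n), Integrable (fun x => φ x * sphereLaplacian ψ x)
      (sphereMeasure n) := fun φ ψ =>
    (φ.contMDiff.continuous.mul (continuous_sphereLaplacian ψ)).integrable_of_hasCompactSupport
      (HasCompactSupport.of_compactSpace _)
  have hi : Integrable (fun x => (n : ℝ) * ((n : ℝ) - 2) / 4 * (φ x * ψ x)) (sphereMeasure n) :=
    (continuous_const.mul (φ.contMDiff.continuous.mul
      ψ.contMDiff.continuous)).integrable_of_hasCompactSupport
        (HasCompactSupport.of_compactSpace _)
  have e1 : ∀ x, φ x * sphereBox ψ x = (n : ℝ) * ((n : ℝ) - 2) / 4 * (φ x * ψ x)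
      - φ x * sphereLaplacian ψ x := fun x => by rw [sphereBox]; ring
  have e2 : ∀ x, ψ x * sphereBox φ x = (n : ℝ) * ((n : ℝ) - 2) / 4 * (φ x * ψ x)
      - ψ x * sphereLaplacian φ x := fun x => by rw [sphereBox]; ring
  simp only [e1, e2]
  rw [integral_sub hi (hci φ ψ), integral_sub hi (hci ψ φ), integral_mul_sphereLaplacian_comm]

end Symmetry

/-! ### Spherical harmonics -/

section Harmonics

variable {n : ℕ}

/-- The restriction to the sphere of a linear form, as a continuous function. -/
def linearForm (n : ℕ) : EuclideanSpace ℝ (Fin (n + 1)) →ₗ[ℝ] C(Sph n, ℝ) where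
  toFun a := ⟨fun x => ⟪a, (x : EuclideanSpace ℝ (Fin (n + 1)))⟫_ℝ, by fun_prop⟩
  map_add' a b := by ext x; simp [inner_add_left]
  map_smul' c a := by ext x; simp [inner_smul_left]

@[simp] theorem linearForm_apply (a : EuclideanSpace ℝ (Fin (n + 1))) (x : Sph n) :
    linearForm n a x = ⟪a, (x : EuclideanSpace ℝ (Fin (n + 1)))⟫_ℝ := rfl

/-- The power of a linear form, as a smooth function on the sphere. -/
def linearPow (a : EuclideanSpace ℝ (Fin (n + 1))) (k : ℕ) : SmoothFun n (Sph n) :=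
  ⟨fun x => ⟪a, (x : EuclideanSpace ℝ (Fin (n + 1)))⟫_ℝ ^ k, by
    have := Fact.mk (@finrank_euclideanSpace_fin ℝ _ (n + 1))
    have h : ContDiff ℝ ∞ fun z : EuclideanSpace ℝ (Fin (n + 1)) => ⟪a, z⟫_ℝ ^ k :=
      (innerSL ℝ a : EuclideanSpace ℝ (Fin (n + 1)) →L[ℝ] ℝ).contDiff.pow k
    exact h.contMDiff.comp contMDiff_coe_sphere⟩

theorem linearPow_apply (a : EuclideanSpace ℝ (Fin (n + 1))) (k : ℕ) (x : Sph n) :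
    linearPow a k x = ⟪a, (x : EuclideanSpace ℝ (Fin (n + 1)))⟫_ℝ ^ k := rfl

variable (n) in
/-- The Hilbert space of square integrable functions on the round sphere. -/
abbrev SphereL2 : Type := Lp ℝ 2 (sphereMeasure n)

/-- The class in `L²` of a continuous function. -/
abbrev contL2 (f : C(Sph n, ℝ)) : SphereL2 n := ContinuousMap.toLp 2 (sphereMeasure n) ℝ f

/-- A smooth function, as a continuous function. -/
def smoothCont (φ : SmoothFun n (Sph n)) : C(Sph n, ℝ) := ⟨φ, φ.contMDiff.continuous⟩

/-- The conformal Laplacian of a smooth function, as a continuous function. -/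
def boxCont (φ : SmoothFun n (Sph n)) : C(Sph n, ℝ) := ⟨sphereBox φ, continuous_sphereBox φ⟩

theorem inner_contL2 (w : SphereL2 n) (f : C(Sph n, ℝ)) :
    ⟪w, contL2 f⟫_ℝ = ∫ x, w x * f x ∂sphereMeasure n := by
  rw [L2.inner_def]
  refine integral_congr_ae ?_
  filter_upwards [ContinuousMap.coeFn_toLp (p := 2) (𝕜 := ℝ) (sphereMeasure n) f] with x hx
  rw [hx]
  simp [mul_comm]

theorem inner_contL2_contL2 (f g : C(Sph n, ℝ)) :
    ⟪contL2 f, contL2 g⟫_ℝ = ∫ x, f x * g x ∂sphereMeasure n := by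
  rw [ContinuousMap.inner_toLp]
  simp [mul_comm]

variable (n) in
/-- The graph of the conformal Laplacian on smooth functions. -/
def boxGraph : Submodule ℝ (SphereL2 n × SphereL2 n) :=
  Submodule.span ℝ (Set.range fun φ : SmoothFun n (Sph n) =>
    (contL2 (smoothCont φ), contL2 (boxCont φ)))

/-- Because the graph is a linear span, symmetry on smooth functions extends to it by bilinearity,
and linear combinations can be used as if □ were an operator on L² classes. -/
theorem boxGraph_symmetric {p q : SphereL2 n × SphereL2 n} (hp : p ∈ boxGraph n)
    (hq : q ∈ boxGraph n) : ⟪p.2, q.1⟫_ℝ = ⟪p.1, q.2⟫_ℝ := by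
  induction hp using Submodule.span_induction with
  | mem p hp =>
    obtain ⟨φ, rfl⟩ := hp
    induction hq using Submodule.span_induction with
    | mem q hq =>
      obtain ⟨ψ, rfl⟩ := hq
      simp only
      rw [real_inner_comm, inner_contL2_contL2, inner_contL2_contL2]
      exact integral_mul_sphereBox_comm ψ φ
    | zero => simp
    | add q q' _ _ h h' => simp [inner_add_right, h, h']
    | smul c q _ h => simp [inner_smul_right, h]
  | zero => simp
  | add p p' _ _ h h' => simp [inner_add_left, h, h']
  | smul c p _ h => simp [inner_smul_left, h]

/-- The eigenvalues of the conformal Laplacian of the round sphere. -/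
def boxEigenvalue (n k : ℕ) : ℝ := (k : ℝ) * (k + n - 1) + (n : ℝ) * ((n : ℝ) - 2) / 4

theorem boxCont_linearPow (a : EuclideanSpace ℝ (Fin (n + 1))) (k : ℕ) :
    boxCont (linearPow a k) = boxEigenvalue n k • smoothCont (linearPow a k)
      - ((k : ℝ) * (k - 1) * ‖a‖ ^ 2) • smoothCont (linearPow a (k - 2)) := by
  ext x
  have h : sphereBox (linearPow a k) x = -sphereLaplacian (fun z : Sph n => ⟪a, z⟫_ℝ ^ k) x
    + (n : ℝ) * ((n : ℝ) - 2) / 4 * ⟪a, x⟫_ℝ ^ k := rfl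
  rw [sphereLaplacian_inner_pow] at h
  refine h.trans ?_
  simp [smoothCont, linearPow_apply, boxEigenvalue]
  ring

variable (n) in
/-- The span of the powers of degree less than `k` of linear forms. -/
def polyL2 (k : ℕ) : Submodule ℝ (SphereL2 n) :=
  Submodule.span ℝ {f | ∃ a : EuclideanSpace ℝ (Fin (n + 1)), ∃ j < k,
    f = contL2 (smoothCont (linearPow a j))}

theorem polyL2_mono {j k : ℕ} (h : j ≤ k) : polyL2 n j ≤ polyL2 n k := by
  refine Submodule.span_mono ?_
  rintro f ⟨a, i, hi, rfl⟩
  exact ⟨a, i, hi.trans_le h, rfl⟩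

theorem contL2_linearPow_mem (a : EuclideanSpace ℝ (Fin (n + 1))) {j k : ℕ} (h : j < k) :
    contL2 (smoothCont (linearPow a j)) ∈ polyL2 n k :=
  Submodule.subset_span ⟨a, j, h, rfl⟩

theorem polyL2_zero : polyL2 n 0 = ⊥ := by
  rw [polyL2, Submodule.span_eq_bot]
  rintro f ⟨a, j, hj, rfl⟩
  omega

/-- Triangularity: □ multiplies a power of degree k by the k-th eigenvalue up to a term of degree k
- 2, and generators of lower degree already lie in `polyL2 n k`. -/
theorem exists_boxGraph_sub_mem {k : ℕ} {p : SphereL2 n} (hp : p ∈ polyL2 n (k + 1)) :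
    ∃ g, (p, g) ∈ boxGraph n ∧ g - boxEigenvalue n k • p ∈ polyL2 n k := by
  induction hp using Submodule.span_induction with
  | mem p hp =>
    obtain ⟨a, j, hj, rfl⟩ := hp
    refine ⟨contL2 (boxCont (linearPow a j)), Submodule.subset_span ⟨_, rfl⟩, ?_⟩
    have e : contL2 (boxCont (linearPow a j))
        - boxEigenvalue n k • contL2 (smoothCont (linearPow a j))
        = (boxEigenvalue n j - boxEigenvalue n k) • contL2 (smoothCont (linearPow a j))
          - ((j : ℝ) * (j - 1) * ‖a‖ ^ 2) • contL2 (smoothCont (linearPow a (j - 2))) := by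
      simp only [contL2, boxCont_linearPow, map_sub, map_smul]
      module
    rw [e]
    refine Submodule.sub_mem _ ?_ ?_
    · rcases Nat.lt_succ_iff_lt_or_eq.1 hj with h | rfl
      · exact Submodule.smul_mem _ _ (contL2_linearPow_mem a h)
      · simp
    -- At j = 0 the truncated degree j - 2 = 0 need not be below k, but the coefficient j (j - 1) is
    -- zero.
    · rcases j with _ | j
      · simp
      · exact Submodule.smul_mem _ _ (contL2_linearPow_mem a (by omega))
  | zero => exact ⟨0, Submodule.zero_mem _, by simp⟩
  | add p q _ _ hp hq =>
    obtain ⟨g, hg, hg'⟩ := hp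
    obtain ⟨h, hh, hh'⟩ := hq
    refine ⟨g + h, by simpa using Submodule.add_mem _ hg hh, ?_⟩
    convert! Submodule.add_mem _ hg' hh' using 1
    module
  | smul c p _ hp =>
    obtain ⟨g, hg, hg'⟩ := hp
    refine ⟨c • g, by simpa using Submodule.smul_mem _ c hg, ?_⟩
    convert! Submodule.smul_mem _ c hg' using 1
    module

theorem exists_boxGraph_mem {k : ℕ} {p : SphereL2 n} (hp : p ∈ polyL2 n k) :
    ∃ g ∈ polyL2 n k, (p, g) ∈ boxGraph n := by
  obtain ⟨g, hg, hg'⟩ := exists_boxGraph_sub_mem (polyL2_mono k.le_succ hp)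
  refine ⟨g, ?_, hg⟩
  have := Submodule.add_mem _ hg' (Submodule.smul_mem _ (boxEigenvalue n k) hp)
  simpa using this

variable (n) in
/-- The spherical harmonics of degree `k`. -/
def harmonicL2 (k : ℕ) : Submodule ℝ (SphereL2 n) := (polyL2 n k)ᗮ ⊓ polyL2 n (k + 1)

/-- A symmetric triangular operator is diagonal on orthogonal increments. The defect d = □w - λ w
lies in the lower space, which □ preserves, so ⟪□w, d⟫ = ⟪w, □d⟫ = 0 and ⟪w, d⟫ = 0; hence ‖d‖² = 0.
-/
theorem boxGraph_harmonicL2 {k : ℕ} {w : SphereL2 n} (hw : w ∈ harmonicL2 n k) :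
    (w, boxEigenvalue n k • w) ∈ boxGraph n := by
  obtain ⟨g, hg, hg'⟩ := exists_boxGraph_sub_mem hw.2
  obtain ⟨r, hr, hr'⟩ := exists_boxGraph_mem hg'
  have h1 := boxGraph_symmetric hg hr'
  have h2 : ⟪w, r⟫_ℝ = 0 := by rw [real_inner_comm]; exact hw.1 r hr
  have h3 : ⟪w, g - boxEigenvalue n k • w⟫_ℝ = 0 := by rw [real_inner_comm]; exact hw.1 _ hg'
  have h4 : ⟪g - boxEigenvalue n k • w, g - boxEigenvalue n k • w⟫_ℝ = 0 := by
    simp only at h1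
    rw [inner_sub_left, h1, h2, inner_smul_left, h3]
    simp
  have h5 := sub_eq_zero.1 (inner_self_eq_zero.1 h4)
  rwa [← h5]

theorem inner_harmonicL2_boxCont {k : ℕ} {w : SphereL2 n} (hw : w ∈ harmonicL2 n k)
    (φ : SmoothFun n (Sph n)) :
    ⟪contL2 (boxCont φ), w⟫_ℝ = boxEigenvalue n k * ⟪contL2 (smoothCont φ), w⟫_ℝ := by
  have h := boxGraph_symmetric (n := n) (p := (contL2 (smoothCont φ), contL2 (boxCont φ)))
    (Submodule.subset_span ⟨φ, rfl⟩) (boxGraph_harmonicL2 hw)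
  simpa [inner_smul_right] using h

theorem harmonicL2_isOrtho (j k : ℕ) (h : j ≠ k) : harmonicL2 n j ⟂ harmonicL2 n k := by
  wlog hjk : j < k generalizing j k
  · exact (this k j h.symm (by omega)).symm
  · refine Submodule.IsOrtho.mono (inf_le_right.trans (polyL2_mono hjk)) inf_le_left
      (Submodule.isOrtho_orthogonal_right _)

instance finiteDimensional_polyL2 (k : ℕ) : FiniteDimensional ℝ (polyL2 n k) := by
  set L : Submodule ℝ C(Sph n, ℝ) := LinearMap.range (linearForm n) with hL
  -- Powers of degree j lie in the j-th power, inside the algebra C(Sⁿ), of the finite-dimensional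
  -- space of linear forms.
  have hLfg : ∀ j, (L ^ j).FG := fun j =>
    Submodule.FG.pow (Module.Finite.iff_fg.1 (inferInstance : Module.Finite ℝ L)) j
  have : ∀ j : Fin k, FiniteDimensional ℝ (L ^ (j : ℕ) : Submodule ℝ C(Sph n, ℝ)) := fun j =>
    Module.Finite.iff_fg.2 (hLfg j)
  set Q : Submodule ℝ C(Sph n, ℝ) := ⨆ j : Fin k, L ^ (j : ℕ)
  have hQ : FiniteDimensional ℝ Q := Submodule.finiteDimensional_iSup _
  have hle : polyL2 n k ≤ Q.map (ContinuousMap.toLp 2 (sphereMeasure n) ℝ).toLinearMap := by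
    refine Submodule.span_le.2 ?_
    rintro f ⟨a, j, hj, rfl⟩
    refine ⟨smoothCont (linearPow a j), ?_, rfl⟩
    have h1 : smoothCont (linearPow a j) = linearForm n a ^ j := by
      ext x
      simp [smoothCont, linearPow_apply]
    rw [h1]
    exact Submodule.mem_iSup_of_mem (p := fun j : Fin k => L ^ (j : ℕ)) ⟨j, hj⟩
      (Submodule.pow_mem_pow L ⟨a, rfl⟩ j)
  exact Submodule.finiteDimensional_of_le hle

instance finiteDimensional_harmonicL2 (k : ℕ) : FiniteDimensional ℝ (harmonicL2 n k) :=
  Submodule.finiteDimensional_of_le (inf_le_right : harmonicL2 n k ≤ polyL2 n (k + 1))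

/-- A continuous linear functional on `C(Sⁿ)` that vanishes on the powers of linear forms is
zero. -/
theorem functional_eq_zero_of_linearForm_pow (Λ : C(Sph n, ℝ) →L[ℝ] ℝ)
    (h : ∀ a k, Λ (linearForm n a ^ k) = 0) : Λ = 0 := by
  let _ : NormedAlgebra ℚ C(Sph n, ℝ) := NormedAlgebra.restrictScalars ℚ ℝ C(Sph n, ℝ)
  have hexp : ∀ a, Λ (NormedSpace.exp (linearForm n a)) = 0 := by
    intro a
    have h1 := (NormedSpace.exp_series_hasSum_exp' (𝕂 := ℝ) (linearForm n a)).mapL Λ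
    simp only [map_smul, h, smul_zero] at h1
    exact h1.unique hasSum_zero
  -- Since exp(a) exp(b) = exp(a + b), the exponentials form a monoid. Their linear span is then
  -- already an algebra, to which Stone-Weierstrass applies.
  let e : Multiplicative (EuclideanSpace ℝ (Fin (n + 1))) →* C(Sph n, ℝ) :=
    { toFun := fun a => NormedSpace.exp (linearForm n a.toAdd)
      map_one' := by simp
      map_mul' := fun a b => by
        rw [toAdd_mul, map_add, NormedSpace.exp_add] }
  set A : Subalgebra ℝ C(Sph n, ℝ) := Algebra.adjoin ℝ (MonoidHom.mrange e : Set C(Sph n, ℝ))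
    with hA
  have hΛA : ∀ f ∈ A, Λ f = 0 := by
    intro f hf
    have h1 : f ∈ Submodule.span ℝ (MonoidHom.mrange e : Set C(Sph n, ℝ)) := by
      have h2 := Algebra.adjoin_eq_span ℝ (MonoidHom.mrange e : Set C(Sph n, ℝ))
      rw [Submonoid.closure_eq] at h2
      rw [← h2]
      exact hf
    have h3 : Submodule.span ℝ (MonoidHom.mrange e : Set C(Sph n, ℝ)) ≤ LinearMap.ker Λ.toLinearMap := by
      refine Submodule.span_le.2 ?_
      rintro f ⟨a, rfl⟩
      exact hexp a.toAdd
    exact h3 h1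
  have hsep : A.SeparatesPoints := by
    intro x y hxy
    -- The linear form given by x - y separates x from y: equal values would give ‖x - y‖² = 0.
    have hval : ∀ z : Sph n, e (Multiplicative.ofAdd
        ((x : EuclideanSpace ℝ (Fin (n + 1))) - y)) z
        = Real.exp ⟪(x : EuclideanSpace ℝ (Fin (n + 1))) - y, z⟫_ℝ := by
      intro z
      have h1 := NormedSpace.map_exp (ContinuousMap.evalAlgHom ℝ ℝ z)
        (ContinuousEvalConst.continuous_eval_const z)
        (linearForm n ((x : EuclideanSpace ℝ (Fin (n + 1))) - y))
      rw [Real.exp_eq_exp_ℝ]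
      exact h1
    refine ⟨_, ⟨e (Multiplicative.ofAdd ((x : EuclideanSpace ℝ (Fin (n + 1))) - y)),
      Algebra.subset_adjoin ⟨_, rfl⟩, rfl⟩, ?_⟩
    intro h1
    replace h1 := (hval x).symm.trans (h1.trans (hval y))
    have h2 := Real.exp_injective h1
    rw [← sub_eq_zero, ← inner_sub_right, inner_self_eq_zero, sub_eq_zero] at h2
    exact hxy (Subtype.ext h2)
  have htop := ContinuousMap.subalgebra_topologicalClosure_eq_top_of_separatesPoints A hsep
  ext f
  have hf : f ∈ closure (A : Set C(Sph n, ℝ)) := by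
    rw [← Subalgebra.topologicalClosure_coe, htop]
    trivial
  have hcl : IsClosed {f : C(Sph n, ℝ) | Λ f = 0} := isClosed_eq Λ.continuous continuous_const
  exact closure_minimal (fun g hg => hΛA g hg) hcl hf

theorem eq_zero_of_forall_inner_linearPow {w : SphereL2 n}
    (h : ∀ a k, ⟪w, contL2 (smoothCont (linearPow a k))⟫_ℝ = 0) : w = 0 := by
  have h1 : (innerSL ℝ w).comp (ContinuousMap.toLp 2 (sphereMeasure n) ℝ) = 0 := by
    refine functional_eq_zero_of_linearForm_pow _ fun a k => ?_
    have e : smoothCont (linearPow a k) = linearForm n a ^ k := by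
      ext x
      simp [smoothCont, linearPow_apply]
    rw [← e]
    exact h a k
  have hd : DenseRange (ContinuousMap.toLp (E := ℝ) 2 (sphereMeasure n) ℝ) :=
    ContinuousMap.toLp_denseRange ℝ (sphereMeasure n) ℝ (by simp)
  have h2 := hd.equalizer (g := fun v => ⟪w, v⟫_ℝ) (h := fun _ => 0) (by fun_prop)
    continuous_const (funext fun f => congrArg (fun L => L f) h1)
  exact inner_self_eq_zero.1 (congr_fun h2 w)

/-- Inductively, `polyL2 n (k + 1)` is the sum of `polyL2 n k` and the harmonics of degree k, so `w`
is orthogonal to every power of a linear form. -/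
theorem eq_zero_of_forall_mem_orthogonal_harmonicL2 {w : SphereL2 n}
    (h : ∀ k, w ∈ (harmonicL2 n k)ᗮ) : w = 0 := by
  have h1 : ∀ k, w ∈ (polyL2 n k)ᗮ := by
    intro k
    induction k with
    | zero => simp [polyL2_zero]
    | succ k ih =>
      rw [← Submodule.sup_orthogonal_inf_of_hasOrthogonalProjection (polyL2_mono k.le_succ),
        ← Submodule.inf_orthogonal]
      exact ⟨ih, h k⟩
  refine eq_zero_of_forall_inner_linearPow fun a k => ?_
  rw [real_inner_comm]
  exact h1 (k + 1) _ (contL2_linearPow_mem a k.lt_succ_self)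

end Harmonics

/-! ### The Green operator of the round sphere -/

section Green

variable {n : ℕ}

/-- The case n = 3 is the extreme one, where the eigenvalue is (k + 1)² - 1/4. The quadratic bound
yields both positivity and summability of the inverses; each eigenvalue is counted once, whatever
its multiplicity. -/
theorem boxEigenvalue_bounds (hn : 3 ≤ n) (k : ℕ) :
    3 / 4 * ((k : ℝ) + 1) ^ 2 ≤ boxEigenvalue n k ∧ boxEigenvalue n 0 ≤ boxEigenvalue n k := by
  have hn' : (3 : ℝ) ≤ n := by exact_mod_cast hn
  have hk : (0 : ℝ) ≤ k := Nat.cast_nonneg k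
  simp only [boxEigenvalue, Nat.cast_zero, zero_mul, zero_add]
  constructor <;> nlinarith [mul_nonneg hk (by linarith : (0 : ℝ) ≤ n - 3)]

theorem boxEigenvalue_pos (hn : 3 ≤ n) (k : ℕ) : 0 < boxEigenvalue n k :=
  lt_of_lt_of_le (by positivity) (boxEigenvalue_bounds hn k).1

theorem summable_inv_boxEigenvalue (hn : 3 ≤ n) : Summable fun k => (boxEigenvalue n k)⁻¹ := by
  have h1 : Summable fun k : ℕ => 4 / 3 * (1 / ((k + 1 : ℕ) : ℝ) ^ 2) :=
    ((summable_nat_add_iff 1).2 (Real.summable_one_div_nat_pow.2 (by norm_num :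
      1 < 2))).mul_left _
  refine Summable.of_nonneg_of_le (fun k => (inv_pos.2 (boxEigenvalue_pos hn k)).le) (fun k => ?_) h1
  refine (inv_anti₀ (by positivity) (boxEigenvalue_bounds hn k).1).trans_eq ?_
  push_cast
  field_simp

variable (n) in
/-- The Green operator of the conformal Laplacian of the round sphere. -/
def greenOperator : SphereL2 n →L[ℝ] SphereL2 n :=
  diagonalOperator (harmonicL2 n) fun k => (boxEigenvalue n k)⁻¹

theorem isCompactOperator_greenOperator (hn : 3 ≤ n) : IsCompactOperator (greenOperator n) :=
  isCompactOperator_diagonalOperator (summable_inv_boxEigenvalue hn)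
    fun k => (inv_pos.2 (boxEigenvalue_pos hn k)).le

theorem isSymmetric_greenOperator (hn : 3 ≤ n) : (greenOperator n).IsSymmetric :=
  isSymmetric_diagonalOperator (summable_inv_boxEigenvalue hn)
    fun k => (inv_pos.2 (boxEigenvalue_pos hn k)).le

theorem inner_greenOperator_nonneg (hn : 3 ≤ n) (f : SphereL2 n) :
    0 ≤ ⟪greenOperator n f, f⟫_ℝ :=
  inner_diagonalOperator_nonneg (summable_inv_boxEigenvalue hn)
    (fun k => (inv_pos.2 (boxEigenvalue_pos hn k)).le) f

theorem eq_zero_of_inner_greenOperator_eq_zero (hn : 3 ≤ n) {f : SphereL2 n}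
    (h : ⟪greenOperator n f, f⟫_ℝ = 0) : f = 0 :=
  eq_zero_of_forall_mem_orthogonal_harmonicL2
    (mem_orthogonal_of_inner_diagonalOperator_eq_zero (summable_inv_boxEigenvalue hn)
      (fun k => inv_pos.2 (boxEigenvalue_pos hn k)) h)

theorem greenOperator_of_mem (hn : 3 ≤ n) {k : ℕ} {f : SphereL2 n} (hf : f ∈ harmonicL2 n k) :
    greenOperator n f = (boxEigenvalue n k)⁻¹ • f :=
  diagonalOperator_apply_of_mem (summable_inv_boxEigenvalue hn)
    (fun k => (inv_pos.2 (boxEigenvalue_pos hn k)).le) harmonicL2_isOrtho hf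

/-- The Green operator inverts the conformal Laplacian. -/
theorem greenOperator_boxCont (hn : 3 ≤ n) (φ : SmoothFun n (Sph n)) :
    greenOperator n (contL2 (boxCont φ)) = contL2 (smoothCont φ) := by
  refine sub_eq_zero.1 (eq_zero_of_forall_mem_orthogonal_harmonicL2 fun k => ?_)
  rw [Submodule.mem_orthogonal']
  intro w hw
  have h1 : ⟪greenOperator n (contL2 (boxCont φ)), w⟫_ℝ
      = ⟪contL2 (boxCont φ), greenOperator n w⟫_ℝ :=
    isSymmetric_greenOperator hn _ _
  rw [inner_sub_left, h1, greenOperator_of_mem hn hw, inner_smul_right,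
    inner_harmonicL2_boxCont hw, ← mul_assoc, inv_mul_cancel₀ (boxEigenvalue_pos hn k).ne', one_mul,
    sub_self]

/-- The constant 1 is the zeroth power of the zero form, and `polyL2 n 0` is trivial. Hence K 1 =
c⁻¹, the fact that makes the sharp constant appear. -/
theorem contL2_one_mem : contL2 (1 : C(Sph n, ℝ)) ∈ harmonicL2 n 0 := by
  refine ⟨by simp [polyL2_zero], ?_⟩
  have h : (1 : C(Sph n, ℝ)) = smoothCont (linearPow 0 0) := by
    ext x
    simp [smoothCont, linearPow_apply]
  rw [h]
  exact contL2_linearPow_mem 0 one_pos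

/-- `w` is a solution in the sense of distributions of `□ w = lam ρ w` on the round sphere. -/
def IsWeakSolution (ρ : SphereL2 n →L[ℝ] SphereL2 n) (lam : ℝ) (w : SphereL2 n) : Prop :=
  ∀ φ : SmoothFun n (Sph n), ⟪w, contL2 (boxCont φ)⟫_ℝ = lam * ⟪ρ w, contL2 (smoothCont φ)⟫_ℝ

theorem isWeakSolution_iff (hn : 3 ≤ n) (ρ : SphereL2 n →L[ℝ] SphereL2 n) (lam : ℝ)
    (w : SphereL2 n) : IsWeakSolution ρ lam w ↔ w = lam • greenOperator n (ρ w) := by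
  constructor
  · intro h
    -- The weak equation extends to the whole graph, hence may be tested on harmonics. On those □
    -- and K act by inverse scalars, and completeness gives the equation in L².
    have hgraph : ∀ p ∈ boxGraph n, ⟪w, p.2⟫_ℝ = lam * ⟪ρ w, p.1⟫_ℝ := by
      intro p hp
      induction hp using Submodule.span_induction with
      | mem p hp => obtain ⟨φ, rfl⟩ := hp; exact h φ
      | zero => simp
      | add p q _ _ hp hq => simp [inner_add_right, hp, hq, mul_add]
      | smul c p _ hp => simp [inner_smul_right, hp, mul_left_comm]
    refine sub_eq_zero.1 (eq_zero_of_forall_mem_orthogonal_harmonicL2 fun k => ?_)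
    rw [Submodule.mem_orthogonal']
    intro u hu
    have h1 := hgraph _ (boxGraph_harmonicL2 hu)
    have h2 : ⟪greenOperator n (ρ w), u⟫_ℝ = ⟪ρ w, greenOperator n u⟫_ℝ :=
      isSymmetric_greenOperator hn _ _
    simp only [inner_smul_right] at h1
    rw [inner_sub_left, inner_smul_left, h2, greenOperator_of_mem hn hu, inner_smul_right]
    have h3 := (boxEigenvalue_pos hn k).ne'
    simp only [conj_trivial]
    field_simp
    rw [mul_comm] at h1
    linarith
  · intro h φ
    have h2 : ⟪greenOperator n (ρ w), contL2 (boxCont φ)⟫_ℝ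
        = ⟪ρ w, greenOperator n (contL2 (boxCont φ))⟫_ℝ :=
      isSymmetric_greenOperator hn _ _
    conv_lhs => rw [h]
    rw [inner_smul_left, h2, greenOperator_boxCont hn]
    simp

/-- The eigenvalues of the conformal Laplacian of the round sphere are at least `n (n - 2) / 4`. -/
theorem IsWeakSolution.le_of_id (hn : 3 ≤ n) {lam : ℝ} {w : SphereL2 n}
    (h : IsWeakSolution (ContinuousLinearMap.id ℝ _) lam w) (hw : w ≠ 0) :
    boxEigenvalue n 0 ≤ lam := by
  rw [isWeakSolution_iff hn] at h
  by_contra hlt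
  refine hw (eq_zero_of_forall_mem_orthogonal_harmonicL2 fun k => ?_)
  rw [Submodule.mem_orthogonal']
  intro u hu
  have h2 : ⟪greenOperator n w, u⟫_ℝ = ⟪w, greenOperator n u⟫_ℝ :=
    isSymmetric_greenOperator hn _ _
  have h1 : ⟪w, u⟫_ℝ = lam * ((boxEigenvalue n k)⁻¹ * ⟪w, u⟫_ℝ) := by
    conv_lhs => rw [h]
    rw [ContinuousLinearMap.id_apply, inner_smul_left, h2, greenOperator_of_mem hn hu,
      inner_smul_right]
    simp
  have h3 := boxEigenvalue_pos hn k
  have h4 := (boxEigenvalue_bounds hn k).2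
  field_simp at h1
  have h5 : (boxEigenvalue n k - lam) * ⟪w, u⟫_ℝ = 0 := by linarith
  exact (mul_eq_zero.1 h5).resolve_left (by linarith)

end Green

/-! ### Multiplication operators -/

section Multiplication

variable {n : ℕ}

/-- Multiplication by a continuous function, on `L²` of the sphere. -/
def mulL2 (f : C(Sph n, ℝ)) : SphereL2 n →L[ℝ] SphereL2 n :=
  (ContinuousLinearMap.mul ℝ ℝ).holderL (sphereMeasure n) ⊤ 2 2
    (ContinuousMap.toLp ⊤ (sphereMeasure n) ℝ f)

theorem coeFn_mulL2 (f : C(Sph n, ℝ)) (w : SphereL2 n) :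
    mulL2 f w =ᵐ[sphereMeasure n] fun x => f x * w x := by
  have h := (ContinuousLinearMap.mul ℝ ℝ).coeFn_holder (r := 2)
    (ContinuousMap.toLp ⊤ (sphereMeasure n) ℝ f) w
  have h2 := ContinuousMap.coeFn_toLp (p := ⊤) (𝕜 := ℝ) (sphereMeasure n) f
  filter_upwards [h, h2] with x hx hx2
  rw [hx2] at hx
  exact hx

theorem mulL2_mul (f g : C(Sph n, ℝ)) (w : SphereL2 n) :
    mulL2 f (mulL2 g w) = mulL2 (f * g) w := by
  refine Lp.ext ?_
  filter_upwards [coeFn_mulL2 f (mulL2 g w), coeFn_mulL2 g w, coeFn_mulL2 (f * g) w]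
    with x h1 h2 h3
  rw [h1, h2, h3, ContinuousMap.mul_apply, mul_assoc]

theorem mulL2_contL2 (f g : C(Sph n, ℝ)) : mulL2 f (contL2 g) = contL2 (f * g) := by
  refine Lp.ext ?_
  filter_upwards [coeFn_mulL2 f (contL2 g),
    ContinuousMap.coeFn_toLp (p := 2) (𝕜 := ℝ) (sphereMeasure n) g,
    ContinuousMap.coeFn_toLp (p := 2) (𝕜 := ℝ) (sphereMeasure n) (f * g)] with x h1 h2 h3
  rw [h1, h2, h3, ContinuousMap.mul_apply]

theorem mulL2_one (w : SphereL2 n) : mulL2 1 w = w := by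
  refine Lp.ext ?_
  filter_upwards [coeFn_mulL2 1 w] with x h1
  rw [h1, ContinuousMap.one_apply, one_mul]

theorem inner_mulL2_left (f : C(Sph n, ℝ)) (v w : SphereL2 n) :
    ⟪mulL2 f v, w⟫_ℝ = ⟪v, mulL2 f w⟫_ℝ := by
  rw [L2.inner_def, L2.inner_def]
  refine integral_congr_ae ?_
  filter_upwards [coeFn_mulL2 f v, coeFn_mulL2 f w] with x h1 h2
  rw [h1, h2]
  simp
  ring

end Multiplication

/-! ### The weighted eigenvalue problem -/

section Weighted

variable {n : ℕ}

/-- Pairing w = λ K(ρw) with ρw gives ⟪w, ρw⟫ = λ ⟪Kρw, ρw⟫ with both forms nonnegative. If λ < 0,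
the right-hand form vanishes, so ρw = 0 by definiteness and w = λ K 0 = 0. -/
theorem IsWeakSolution.nonneg (hn : 3 ≤ n) {s : C(Sph n, ℝ)} {lam : ℝ} {w : SphereL2 n}
    (h : IsWeakSolution (mulL2 (s * s)) lam w) (hw : w ≠ 0) : 0 ≤ lam := by
  rw [isWeakSolution_iff hn] at h
  have h1 : ⟪w, mulL2 (s * s) w⟫_ℝ
      = lam * ⟪greenOperator n (mulL2 (s * s) w), mulL2 (s * s) w⟫_ℝ := by
    conv_lhs => rw [h]
    rw [inner_smul_left, ← h]
    simp
  have h2 : 0 ≤ ⟪w, mulL2 (s * s) w⟫_ℝ := by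
    rw [← mulL2_mul, ← inner_mulL2_left]
    exact real_inner_self_nonneg
  by_contra hlt
  have h3 := inner_greenOperator_nonneg hn (mulL2 (s * s) w)
  have h4 : ⟪greenOperator n (mulL2 (s * s) w), mulL2 (s * s) w⟫_ℝ = 0 := by
    refine le_antisymm ?_ h3
    by_contra hgt
    nlinarith
  have h5 := eq_zero_of_inner_greenOperator_eq_zero hn h4
  rw [h5] at h
  exact hw (by simpa using h)

/-- The weighted problem has an eigenvalue that is bounded by a Rayleigh quotient of the Green
operator. -/
theorem exists_isWeakSolution (hn : 3 ≤ n) (s : C(Sph n, ℝ)) (hs : ∀ x, 0 < s x) :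
    ∃ lam : ℝ, 0 < lam ∧ (∃ w : SphereL2 n, w ≠ 0 ∧ IsWeakSolution (mulL2 (s * s)) lam w) ∧
      lam * ⟪greenOperator n (contL2 (s * s)), contL2 (s * s)⟫_ℝ
        ≤ ∫ x, s x * s x ∂sphereMeasure n := by
  set M := mulL2 s
  -- Symmetrisation of w ↦ K(s² w), which is not itself symmetric for the unweighted inner product.
  set T : SphereL2 n →L[ℝ] SphereL2 n := M ∘L greenOperator n ∘L M with hT
  have hTapp : ∀ v, T v = M (greenOperator n (M v)) := fun v => rfl
  have hinner : ∀ v w, ⟪T v, w⟫_ℝ = ⟪greenOperator n (M v), M w⟫_ℝ := fun v w => by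
    rw [hTapp, inner_mulL2_left]
  have hc : IsCompactOperator T :=
    ((isCompactOperator_greenOperator hn).comp_clm M).clm_comp M
  have hsymm : T.IsSymmetric := by
    intro v w
    change ⟪T v, w⟫_ℝ = ⟪v, T w⟫_ℝ
    rw [real_inner_comm (T w) v, hinner, hinner]
    exact (isSymmetric_greenOperator hn (M v) (M w)).trans (real_inner_comm _ _)
  have hpos : ∀ v, 0 ≤ ⟪T v, v⟫_ℝ := fun v => by
    rw [hinner]
    exact inner_greenOperator_nonneg hn _
  have hMs : M (contL2 s) = contL2 (s * s) := mulL2_contL2 s s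
  -- The Rayleigh quotient of T at the vector s: ⟪T s, s⟫ = ⟪K s², s²⟫ ≤ ‖T‖ ∫ s².
  have hray : ⟪greenOperator n (contL2 (s * s)), contL2 (s * s)⟫_ℝ
      ≤ ‖T‖ * ∫ x, s x * s x ∂sphereMeasure n := by
    rw [← hMs, ← hinner, ← inner_contL2_contL2]
    refine (real_inner_le_norm _ _).trans ?_
    rw [real_inner_self_eq_norm_sq, sq, ← mul_assoc]
    exact mul_le_mul_of_nonneg_right (T.le_opNorm _) (norm_nonneg _)
  -- If T = 0, then ⟪K s², s²⟫ = 0, so s² is zero in L² and, being continuous, zero everywhere.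
  have hT0 : T ≠ 0 := by
    intro h0
    have h1 : ⟪greenOperator n (contL2 (s * s)), contL2 (s * s)⟫_ℝ = 0 := by
      rw [← hMs, ← hinner, h0]
      simp
    have h2 : contL2 (s * s) = contL2 0 := by
      rw [eq_zero_of_inner_greenOperator_eq_zero hn h1, contL2, map_zero]
    have h3 := ContinuousMap.toLp_injective (p := 2) (𝕜 := ℝ) (sphereMeasure n) h2
    obtain ⟨x⟩ : Nonempty (Sph n) := (NormedSpace.sphere_nonempty.2 zero_le_one).to_subtype
    exact (mul_pos (hs x) (hs x)).ne' (DFunLike.congr_fun h3 x)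
  obtain ⟨v, hv0, hv⟩ := exists_eigenvector_norm hc hsymm hpos hT0
  have hnorm : 0 < ‖T‖ := norm_pos_iff.2 hT0
  -- With T v = ‖T‖ v, the function w = ‖T‖⁻¹ K(s v) satisfies s w = v, so ‖T‖⁻¹ K(s² w) = ‖T‖⁻¹ K(s
  -- v) = w.
  refine ⟨‖T‖⁻¹, inv_pos.2 hnorm, ⟨‖T‖⁻¹ • greenOperator n (M v), ?_, ?_⟩, ?_⟩
  · intro h
    have h1 : ‖T‖⁻¹ • T v = 0 := by rw [hTapp, ← map_smul, h, map_zero]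
    rw [hv, smul_smul, inv_mul_cancel₀ hnorm.ne', one_smul] at h1
    exact hv0 h1
  · rw [isWeakSolution_iff hn, ← mulL2_mul]
    have h1 : M (‖T‖⁻¹ • greenOperator n (M v)) = v := by
      rw [map_smul, ← hTapp, hv, smul_smul, inv_mul_cancel₀ hnorm.ne', one_smul]
    change _ = ‖T‖⁻¹ • greenOperator n (M (M _))
    rw [h1]
  · rw [inv_mul_le_iff₀ hnorm]
    exact hray

theorem sphereMeasure_real_univ_pos : 0 < (sphereMeasure n).real univ :=
  measureReal_nonneg.lt_of_ne' fun h =>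
    Measure.toSphere_ne_zero _ (Measure.measure_univ_eq_zero.1 ((measureReal_eq_zero_iff).1 h))

/-- The Cauchy-Schwarz inequality for the Green operator and its case of equality. -/
theorem inner_greenOperator_ge (hn : 3 ≤ n) (f : C(Sph n, ℝ)) :
    (∫ x, f x ∂sphereMeasure n) ^ 2 ≤
      boxEigenvalue n 0 * (sphereMeasure n).real univ
        * ⟪greenOperator n (contL2 f), contL2 f⟫_ℝ ∧
    (boxEigenvalue n 0 * (sphereMeasure n).real univ
        * ⟪greenOperator n (contL2 f), contL2 f⟫_ℝ ≤ (∫ x, f x ∂sphereMeasure n) ^ 2 →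
      ∃ t : ℝ, ∀ x, f x = t) := by
  set c := boxEigenvalue n 0 with hc
  have hc0 : 0 < c := boxEigenvalue_pos hn 0
  set V := (sphereMeasure n).real univ with hV
  have hV0 : 0 < V := sphereMeasure_real_univ_pos
  set I := ∫ x, f x ∂sphereMeasure n with hI
  set t := I / V with ht
  set e := contL2 (1 : C(Sph n, ℝ)) with he
  have hKe : greenOperator n e = c⁻¹ • e := greenOperator_of_mem hn contL2_one_mem
  have hee : ⟪e, e⟫_ℝ = V := by
    rw [he, inner_contL2_contL2]
    simp [hV]
  have hef : ⟪contL2 f, e⟫_ℝ = I := by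
    rw [he, inner_contL2_contL2]
    simp [hI]
  have hfe : ⟪e, contL2 f⟫_ℝ = I := by rw [real_inner_comm, hef]
  have hKf : ⟪greenOperator n (contL2 f), e⟫_ℝ = c⁻¹ * I := by
    have h1 : ⟪greenOperator n (contL2 f), e⟫_ℝ = ⟪contL2 f, greenOperator n e⟫_ℝ :=
      isSymmetric_greenOperator hn _ _
    rw [h1, hKe, inner_smul_right, hef]
  -- Here t is the mean of f, so f - t is orthogonal to the constants, and the mixed terms combine
  -- to -c⁻¹ I² / V.
  have key : ⟪greenOperator n (contL2 f - t • e), contL2 f - t • e⟫_ℝ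
      = ⟪greenOperator n (contL2 f), contL2 f⟫_ℝ - c⁻¹ * (I ^ 2 / V) := by
    rw [map_sub, map_smul, hKe, inner_sub_left, inner_sub_right, inner_sub_right, inner_smul_right,
      hKf, inner_smul_left, inner_smul_left, inner_smul_left, inner_smul_left, inner_smul_right,
      hee, hfe, ht]
    simp only [conj_trivial]
    field_simp
    ring
  have h1 := inner_greenOperator_nonneg hn (contL2 f - t • e)
  refine ⟨?_, fun hle => ⟨t, ?_⟩⟩
  · rw [key] at h1
    field_simp at h1
    linarith
  · have h2 : ⟪greenOperator n (contL2 f - t • e), contL2 f - t • e⟫_ℝ = 0 := by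
      refine le_antisymm ?_ h1
      rw [key]
      field_simp
      linarith
    have h3 := eq_zero_of_inner_greenOperator_eq_zero hn h2
    have h4 : contL2 f = contL2 (t • 1 : C(Sph n, ℝ)) := by
      rw [contL2, contL2, map_smul]
      exact sub_eq_zero.1 h3
    have h5 := ContinuousMap.toLp_injective (p := 2) (𝕜 := ℝ) (sphereMeasure n) h4
    intro x
    rw [h5]
    simp

end Weighted

/-! ### Measures with a continuous positive density -/

section Density

variable {X : Type*} [MeasurableSpace X] {ν : Measure X} {d : X → ℝ}

theorem withDensity_le_smul_of_le {f : X → ENNReal} {C : ENNReal} (h : ∀ x, f x ≤ C) :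
    ν.withDensity f ≤ C • ν := by
  rw [← withDensity_const]
  exact withDensity_mono (Filter.Eventually.of_forall h)

variable [TopologicalSpace X] [OpensMeasurableSpace X]

theorem ae_eq_withDensity_ofReal_iff (hd : Continuous d) (hpos : ∀ x, 0 < d x) {f g : X → ℝ} :
    f =ᵐ[ν.withDensity fun x => ENNReal.ofReal (d x)] g ↔ f =ᵐ[ν] g :=
  withDensity_ae_eq hd.measurable.ennreal_ofReal.aemeasurable
    (Filter.Eventually.of_forall fun x => (ENNReal.ofReal_pos.2 (hpos x)).ne')

theorem integral_withDensity_ofReal (hd : Continuous d) (hpos : ∀ x, 0 < d x) (f : X → ℝ) :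
    ∫ x, f x ∂(ν.withDensity fun x => ENNReal.ofReal (d x)) = ∫ x, d x * f x ∂ν := by
  rw [integral_withDensity_eq_integral_toReal_smul hd.measurable.ennreal_ofReal
    (Filter.Eventually.of_forall fun x => ENNReal.ofReal_lt_top)]
  simp only [ENNReal.toReal_ofReal (hpos _).le, smul_eq_mul]

/-- By compactness the density is bounded above and away from zero, so each measure is at most a
finite multiple of the other. -/
theorem memLp_withDensity_ofReal_iff [CompactSpace X] (hd : Continuous d) (hpos : ∀ x, 0 < d x) {p : ENNReal}
    {f : X → ℝ} : MemLp f p (ν.withDensity fun x => ENNReal.ofReal (d x)) ↔ MemLp f p ν := by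
  have hbd : ∀ e : X → ℝ, Continuous e → ∃ C : ℝ, ∀ x, e x ≤ C := fun e he => by
    obtain ⟨C, hC⟩ := (isCompact_range he).bddAbove
    exact ⟨C, fun x => hC ⟨x, rfl⟩⟩
  obtain ⟨C, hC⟩ := hbd d hd
  obtain ⟨C', hC'⟩ := hbd (fun x => (d x)⁻¹) (hd.inv₀ fun x => (hpos x).ne')
  constructor
  · intro h
    have h1 := withDensity_inv_same (μ := ν) (f := fun x => ENNReal.ofReal (d x))
      hd.measurable.ennreal_ofReal
      (Filter.Eventually.of_forall fun x => (ENNReal.ofReal_pos.2 (hpos x)).ne')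
      (Filter.Eventually.of_forall fun x => ENNReal.ofReal_ne_top)
    rw [← h1]
    refine h.of_measure_le_smul (c := ENNReal.ofReal C') ENNReal.ofReal_ne_top
      (withDensity_le_smul_of_le fun x => ?_)
    rw [← ENNReal.ofReal_inv_of_pos (hpos x)]
    exact ENNReal.ofReal_le_ofReal (hC' x)
  · intro h
    exact h.of_measure_le_smul (c := ENNReal.ofReal C) ENNReal.ofReal_ne_top
      (withDensity_le_smul_of_le fun x => ENNReal.ofReal_le_ofReal (hC x))

end Density

/-! ### The volume of a conformal metric -/

section Volume

variable {n : ℕ}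

theorem det_gram_roundMetric_ne_zero (x : Sph n) : (gram (roundMetric n) x).det ≠ 0 := by
  have h : gram (roundMetric n) x = Matrix.gram ℝ (fun i : Fin n =>
      inclDeriv n x (EuclideanSpace.single i (1 : ℝ) : EuclideanSpace ℝ (Fin n))) := rfl
  rw [h, Matrix.det_gram_ne_zero_iff_linearIndependent]
  have h1 : LinearIndependent ℝ fun i : Fin n =>
      (EuclideanSpace.single i (1 : ℝ) : EuclideanSpace ℝ (Fin n)) := by
    have h2 := (EuclideanSpace.basisFun (Fin n) ℝ).orthonormal.linearIndependent
    rw [funext (EuclideanSpace.basisFun_apply (Fin n) ℝ)] at h2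
    exact h2
  exact h1.map' (inclDeriv n x).toLinearMap (LinearMap.ker_eq_bot.2 (inclDeriv_injective n x))

theorem riemannianVolume_roundMetric : riemannianVolume (roundMetric n) = sphereMeasure n := by
  simp [riemannianVolume, div_self (det_gram_roundMetric_ne_zero _)]

/-- The conformal factor `μ ^ (2 / (n - 2))` of lengths. -/
def lengthFactor (μ : PosFun n (Sph n)) : C(Sph n, ℝ) :=
  ⟨fun x => μ.1 x ^ (2 / ((n : ℝ) - 2)),
    μ.1.contMDiff.continuous.rpow_const fun x => Or.inl (μ.2 x).ne'⟩

theorem lengthFactor_pos (μ : PosFun n (Sph n)) (x : Sph n) : 0 < lengthFactor μ x :=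
  Real.rpow_pos_of_pos (μ.2 x) _

theorem lengthFactor_mul_self (μ : PosFun n (Sph n)) (x : Sph n) :
    lengthFactor μ x * lengthFactor μ x = μ.1 x ^ (4 / ((n : ℝ) - 2)) := by
  change μ.1 x ^ (2 / ((n : ℝ) - 2)) * μ.1 x ^ (2 / ((n : ℝ) - 2)) = _
  rw [← Real.rpow_add (μ.2 x)]
  ring_nf

/-- 2n / (n - 2) = 4 / (n - 2) + 2. The volume density thus splits into the weight ρ and a factor
μ², which the substitution w = μ u absorbs. -/
theorem lengthFactor_pow (hn : 3 ≤ n) (μ : PosFun n (Sph n)) (x : Sph n) :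
    lengthFactor μ x ^ n = lengthFactor μ x * lengthFactor μ x * μ.1 x ^ 2 := by
  have hn2 : (0 : ℝ) < (n : ℝ) - 2 := by
    have : (3 : ℝ) ≤ n := by exact_mod_cast hn
    linarith
  rw [lengthFactor_mul_self]
  change (μ.1 x ^ (2 / ((n : ℝ) - 2))) ^ n = _
  rw [← Real.rpow_natCast, ← Real.rpow_mul (μ.2 x).le, ← Real.rpow_natCast (μ.1 x) 2,
    ← Real.rpow_add (μ.2 x)]
  congr 1
  field_simp
  push_cast
  ring

theorem riemannianVolume_conformalMetric (hn : 3 ≤ n) (μ : PosFun n (Sph n)) :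
    riemannianVolume (conformalMetric (roundMetric n) μ) = (sphereMeasure n).withDensity
      fun x => ENNReal.ofReal (lengthFactor μ x * lengthFactor μ x * μ.1 x ^ 2) := by
  unfold riemannianVolume
  congr 1
  funext x
  congr 1
  have h : gram (conformalMetric (roundMetric n) μ) x
      = (lengthFactor μ x * lengthFactor μ x) • gram (roundMetric n) x := by
    rw [lengthFactor_mul_self]
    rfl
  rw [h, Matrix.det_smul, Fintype.card_fin,
    mul_div_cancel_right₀ _ (det_gram_roundMetric_ne_zero x), mul_pow,
    Real.sqrt_mul_self (pow_pos (lengthFactor_pos μ x) n).le, lengthFactor_pow hn]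

end Volume

/-! ### Eigenvalues of the conformal Laplacian of a conformal metric -/

section Eigenvalues

variable {n : ℕ}

/-- The inverse of a positive function. -/
def invFun (μ : PosFun n (Sph n)) : SmoothFun n (Sph n) :=
  ⟨fun x => (μ.1 x)⁻¹, μ.1.contMDiff.inv₀ fun x => (μ.2 x).ne'⟩

theorem mul_invFun_mul (μ : PosFun n (Sph n)) (ψ : SmoothFun n (Sph n)) :
    μ.1 * (invFun μ * ψ) = ψ := by
  ext x
  change μ.1 x * ((μ.1 x)⁻¹ * ψ x) = ψ x
  rw [mul_inv_cancel_left₀ (μ.2 x).ne']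

theorem mulL2_mulL2_invFun (μ : PosFun n (Sph n)) (w : SphereL2 n) :
    mulL2 (smoothCont μ.1) (mulL2 (smoothCont (invFun μ)) w) = w := by
  have h : smoothCont μ.1 * smoothCont (invFun μ) = 1 := by
    ext x
    exact mul_inv_cancel₀ (μ.2 x).ne'
  rw [mulL2_mul, h, mulL2_one]

theorem mulL2_invFun_mulL2 (μ : PosFun n (Sph n)) (w : SphereL2 n) :
    mulL2 (smoothCont (invFun μ)) (mulL2 (smoothCont μ.1) w) = w := by
  rw [mulL2_mul, mul_comm, ← mulL2_mul, mulL2_mulL2_invFun]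

/-- The volume density ρ μ² cancels the prefactor ρ⁻¹ μ⁻¹ of the conformal Laplacian up to one μ. So
the two sides pair μu with □(μφ) and with ρ μφ in the round measure. -/
theorem isWeakSolution_mulL2_iff (hn : 3 ≤ n) (μ : PosFun n (Sph n)) (lam : ℝ) {u : Sph n → ℝ}
    {v : SphereL2 n} (huv : v =ᵐ[sphereMeasure n] u) :
    IsWeakSolution (mulL2 (lengthFactor μ * lengthFactor μ)) lam (mulL2 (smoothCont μ.1) v) ↔
      ∀ φ : SmoothFun n (Sph n),
        ∫ x, u x * conformalLaplacian (conformalMetric (roundMetric n) μ) φ x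
            ∂riemannianVolume (conformalMetric (roundMetric n) μ) =
          lam * ∫ x, u x * φ x ∂riemannianVolume (conformalMetric (roundMetric n) μ) := by
  have hcont : Continuous fun x => lengthFactor μ x * lengthFactor μ x * μ.1 x ^ 2 :=
    ((lengthFactor μ).continuous.mul (lengthFactor μ).continuous).mul
      (μ.1.contMDiff.continuous.pow 2)
  have hpos : ∀ x, 0 < lengthFactor μ x * lengthFactor μ x * μ.1 x ^ 2 := fun x =>
    mul_pos (mul_pos (lengthFactor_pos μ x) (lengthFactor_pos μ x)) (pow_pos (μ.2 x) 2)
  have hbox : ∀ φ : SmoothFun n (Sph n),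
      ∫ x, u x * conformalLaplacian (conformalMetric (roundMetric n) μ) φ x
          ∂riemannianVolume (conformalMetric (roundMetric n) μ)
        = ⟪mulL2 (smoothCont μ.1) v, contL2 (boxCont (μ.1 * φ))⟫_ℝ := by
    intro φ
    rw [riemannianVolume_conformalMetric hn, integral_withDensity_ofReal hcont hpos, inner_contL2]
    refine integral_congr_ae ?_
    filter_upwards [huv, coeFn_mulL2 (smoothCont μ.1) v] with x h1 h2
    rw [h2, h1, conformalLaplacian_conformalMetric hn, ← lengthFactor_mul_self]
    have h3 := (lengthFactor_pos μ x).ne'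
    have h4 := (μ.2 x).ne'
    change _ = μ.1 x * u x * sphereBox (μ.1 * φ : SmoothFun n (Sph n)) x
    field_simp
  have hmass : ∀ φ : SmoothFun n (Sph n),
      ∫ x, u x * φ x ∂riemannianVolume (conformalMetric (roundMetric n) μ)
        = ⟪mulL2 (lengthFactor μ * lengthFactor μ) (mulL2 (smoothCont μ.1) v),
          contL2 (smoothCont (μ.1 * φ))⟫_ℝ := by
    intro φ
    rw [riemannianVolume_conformalMetric hn, integral_withDensity_ofReal hcont hpos, inner_contL2]
    refine integral_congr_ae ?_
    filter_upwards [huv, coeFn_mulL2 (smoothCont μ.1) v,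
      coeFn_mulL2 (lengthFactor μ * lengthFactor μ) (mulL2 (smoothCont μ.1) v)] with x h1 h2 h3
    rw [h3, h2, h1]
    change _ = lengthFactor μ x * lengthFactor μ x * (μ.1 x * u x) * (μ.1 x * φ x)
    ring
  simp only [hbox, hmass]
  -- The test functions μφ exhaust the smooth functions: take φ = μ⁻¹ ψ.
  refine ⟨fun h φ => h _, fun h ψ => ?_⟩
  have h1 := h (invFun μ * ψ)
  rwa [mul_invFun_mul] at h1

theorem isEigenvalue_iff (hn : 3 ≤ n) (μ : PosFun n (Sph n)) (lam : ℝ) :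
    IsEigenvalue (conformalMetric (roundMetric n) μ) lam ↔
      ∃ w : SphereL2 n, w ≠ 0 ∧ IsWeakSolution (mulL2 (lengthFactor μ * lengthFactor μ)) lam w := by
  have hcont : Continuous fun x => lengthFactor μ x * lengthFactor μ x * μ.1 x ^ 2 :=
    ((lengthFactor μ).continuous.mul (lengthFactor μ).continuous).mul
      (μ.1.contMDiff.continuous.pow 2)
  have hpos : ∀ x, 0 < lengthFactor μ x * lengthFactor μ x * μ.1 x ^ 2 := fun x =>
    mul_pos (mul_pos (lengthFactor_pos μ x) (lengthFactor_pos μ x)) (pow_pos (μ.2 x) 2)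
  have hmem : ∀ u : Sph n → ℝ, MemLp u 2 (riemannianVolume (conformalMetric (roundMetric n) μ)) ↔
      MemLp u 2 (sphereMeasure n) := fun u => by
    rw [riemannianVolume_conformalMetric hn, memLp_withDensity_ofReal_iff hcont hpos]
  have hae : ∀ u : Sph n → ℝ, u =ᵐ[riemannianVolume (conformalMetric (roundMetric n) μ)] 0 ↔
      u =ᵐ[sphereMeasure n] 0 := fun u => by
    rw [riemannianVolume_conformalMetric hn, ae_eq_withDensity_ofReal_iff hcont hpos]
  constructor
  · rintro ⟨u, hu, hu0, h⟩
    rw [hmem] at hu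
    rw [hae] at hu0
    refine ⟨mulL2 (smoothCont μ.1) (hu.toLp u), fun h0 => hu0 ?_,
      (isWeakSolution_mulL2_iff hn μ lam hu.coeFn_toLp).2 h⟩
    have h1 : hu.toLp u = 0 := by
      rw [← mulL2_invFun_mulL2 μ (hu.toLp u), h0, map_zero]
    exact hu.coeFn_toLp.symm.trans ((Lp.eq_zero_iff_ae_eq_zero).1 h1)
  · rintro ⟨w, hw0, hw⟩
    set v := mulL2 (smoothCont (invFun μ)) w with hv
    have hvw : mulL2 (smoothCont μ.1) v = w := mulL2_mulL2_invFun μ w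
    refine ⟨v, (hmem _).2 (Lp.memLp v), fun h0 => hw0 ?_,
      (isWeakSolution_mulL2_iff hn μ lam (Filter.EventuallyEq.refl _ _)).1 (by rwa [hvw])⟩
    rw [hae] at h0
    rw [← hvw, (Lp.eq_zero_iff_ae_eq_zero).2 h0, map_zero]

/-- Without a lower bound the real `sInf` would be the default value 0, and no eigenvalue could be
compared with it. -/
theorem bddBelow_isEigenvalue (hn : 3 ≤ n) (μ : PosFun n (Sph n)) :
    BddBelow {lam : ℝ | IsEigenvalue (conformalMetric (roundMetric n) μ) lam} := by
  refine ⟨0, fun lam hlam => ?_⟩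
  obtain ⟨w, hw0, hw⟩ := (isEigenvalue_iff hn μ lam).1 hlam
  exact hw.nonneg hn hw0

theorem lambdaBar_eq (μ : PosFun n (Sph n)) :
    lambdaBar (roundMetric n) μ = lowestEigenvalue (conformalMetric (roundMetric n) μ) *
      ∫ x, (lengthFactor μ * lengthFactor μ) x ∂sphereMeasure n := by
  rw [lambdaBar, riemannianVolume_roundMetric]
  simp only [← lengthFactor_mul_self, ContinuousMap.mul_apply]

theorem lowestEigenvalue_mul_le (hn : 3 ≤ n) (μ : PosFun n (Sph n)) :
    lowestEigenvalue (conformalMetric (roundMetric n) μ) *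
      ⟪greenOperator n (contL2 (lengthFactor μ * lengthFactor μ)),
        contL2 (lengthFactor μ * lengthFactor μ)⟫_ℝ
      ≤ ∫ x, (lengthFactor μ * lengthFactor μ) x ∂sphereMeasure n := by
  obtain ⟨lam, -, hex, hle⟩ := exists_isWeakSolution hn (lengthFactor μ) (lengthFactor_pos μ)
  refine le_trans (mul_le_mul_of_nonneg_right ?_ (inner_greenOperator_nonneg hn _)) hle
  exact csInf_le (bddBelow_isEigenvalue hn μ) ((isEigenvalue_iff hn μ lam).2 hex)

theorem integral_lengthFactor_pos (μ : PosFun n (Sph n)) :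
    0 < ∫ x, (lengthFactor μ * lengthFactor μ) x ∂sphereMeasure n := by
  have hpos : ∀ x, 0 < (lengthFactor μ * lengthFactor μ) x := fun x =>
    mul_pos (lengthFactor_pos μ x) (lengthFactor_pos μ x)
  obtain ⟨x⟩ : Nonempty (Sph n) := (NormedSpace.sphere_nonempty.2 zero_le_one).to_subtype
  exact (lengthFactor μ * lengthFactor μ).continuous.integral_pos_of_hasCompactSupport_nonneg_nonzero
    (HasCompactSupport.of_compactSpace _) (fun x => (hpos x).le) (hpos x).ne'

/-- With L = λ₀, I = ∫ ρ and Q = ⟪Kρ, ρ⟫, the bounds L Q ≤ I and I² ≤ c V Q give L I Q ≤ I² ≤ c V Q.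
Here Q > 0 since I > 0, so Q can be divided out. -/
theorem lambdaBar_le (hn : 3 ≤ n) (μ : PosFun n (Sph n)) :
    lambdaBar (roundMetric n) μ ≤ boxEigenvalue n 0 * (sphereMeasure n).real univ := by
  have h1 := lowestEigenvalue_mul_le hn μ
  have h2 := (inner_greenOperator_ge hn (lengthFactor μ * lengthFactor μ)).1
  have h3 := integral_lengthFactor_pos μ
  have h4 : 0 < boxEigenvalue n 0 * (sphereMeasure n).real univ :=
    mul_pos (boxEigenvalue_pos hn 0) sphereMeasure_real_univ_pos
  rw [lambdaBar_eq]
  set I := ∫ x, (lengthFactor μ * lengthFactor μ) x ∂sphereMeasure n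
  set Q := ⟪greenOperator n (contL2 (lengthFactor μ * lengthFactor μ)),
    contL2 (lengthFactor μ * lengthFactor μ)⟫_ℝ
  set L := lowestEigenvalue (conformalMetric (roundMetric n) μ)
  have hQ : 0 < Q := by
    by_contra hQ
    nlinarith [pow_pos h3 2]
  by_contra! hlt
  have h5 : boxEigenvalue n 0 * (sphereMeasure n).real univ * Q < L * I * Q :=
    mul_lt_mul_of_pos_right hlt hQ
  have h6 : L * Q * I ≤ I * I := mul_le_mul_of_nonneg_right h1 h3.le
  linarith

theorem lambdaBar_one (hn : 3 ≤ n) :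
    lambdaBar (roundMetric n) 1 = boxEigenvalue n 0 * (sphereMeasure n).real univ := by
  refine le_antisymm (lambdaBar_le hn 1) ?_
  have hone : lengthFactor (1 : PosFun n (Sph n)) * lengthFactor 1 = 1 := by
    ext x
    rw [ContinuousMap.mul_apply, lengthFactor_mul_self]
    exact Real.one_rpow _
  rw [lambdaBar_eq, hone]
  simp only [ContinuousMap.one_apply, integral_const, smul_eq_mul, mul_one]
  refine mul_le_mul_of_nonneg_right ?_ measureReal_nonneg
  -- The infimum is bounded below by c only if the set of eigenvalues is nonempty; for ρ = 1 the
  -- weak problem is that of □ itself.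
  obtain ⟨lam, -, hex, -⟩ := exists_isWeakSolution hn (lengthFactor 1) (lengthFactor_pos 1)
  refine le_csInf ⟨lam, (isEigenvalue_iff hn 1 lam).2 hex⟩ fun lam hlam => ?_
  obtain ⟨w, hw0, hw⟩ := (isEigenvalue_iff hn 1 lam).1 hlam
  have hid : mulL2 (1 : C(Sph n, ℝ)) = ContinuousLinearMap.id ℝ (SphereL2 n) :=
    ContinuousLinearMap.ext mulL2_one
  rw [hone, hid] at hw
  exact hw.le_of_id hn hw0

/-- If c V ≤ L I, multiplying by Q ≥ 0 gives c V Q ≤ L I Q ≤ I², the equality case of the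
Cauchy-Schwarz inequality for K. -/
theorem lengthFactor_const_of_le_lambdaBar (hn : 3 ≤ n) (μ : PosFun n (Sph n))
    (h : boxEigenvalue n 0 * (sphereMeasure n).real univ ≤ lambdaBar (roundMetric n) μ) :
    ∃ t : ℝ, ∀ x, (lengthFactor μ * lengthFactor μ) x = t := by
  refine (inner_greenOperator_ge hn (lengthFactor μ * lengthFactor μ)).2 ?_
  have h1 := lowestEigenvalue_mul_le hn μ
  have h3 := integral_lengthFactor_pos μ
  have hQ := inner_greenOperator_nonneg hn (contL2 (lengthFactor μ * lengthFactor μ))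
  rw [lambdaBar_eq] at h
  have h5 := mul_le_mul_of_nonneg_right h hQ
  have h6 := mul_le_mul_of_nonneg_right h1 h3.le
  linarith

end Eigenvalues

end ConformalSphere

end

/-- `Λ₀(Sⁿ, g₀)` is finite and equal to the value of the functional at `g₀` (the factor `μ = 1`),
and only the constant multiples of `g₀` attain it. -/
theorem mainTheorem3 (n : ℕ) (hn : 3 ≤ n) :
    BddAbove (Set.range
      (ConformalSphere.lambdaBar (ConformalSphere.roundMetric n))) ∧
    ConformalSphere.LambdaSup (ConformalSphere.roundMetric n) =
      ConformalSphere.lambdaBar (ConformalSphere.roundMetric n) 1 ∧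
    ∀ μ : ConformalSphere.PosFun n (ConformalSphere.Sph n),
      ConformalSphere.LambdaSup (ConformalSphere.roundMetric n) =
        ConformalSphere.lambdaBar (ConformalSphere.roundMetric n) μ →
      ∃ c : ℝ, 0 < c ∧ ∀ (x : ConformalSphere.Sph n) (v w : TangentSpace (𝓡 n) x),
        (ConformalSphere.conformalMetric (ConformalSphere.roundMetric n) μ).inner x v w =
          c * (ConformalSphere.roundMetric n).inner x v w := by
  have hone := ConformalSphere.lambdaBar_one hn
  have hbdd : BddAbove (Set.range
      (ConformalSphere.lambdaBar (ConformalSphere.roundMetric n))) :=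
    ⟨_, Set.forall_mem_range.2 (ConformalSphere.lambdaBar_le hn)⟩
  have hsup : ConformalSphere.LambdaSup (ConformalSphere.roundMetric n) =
      ConformalSphere.lambdaBar (ConformalSphere.roundMetric n) 1 :=
    le_antisymm (ciSup_le fun μ => (ConformalSphere.lambdaBar_le hn μ).trans_eq hone.symm)
      (le_ciSup hbdd 1)
  refine ⟨hbdd, hsup, fun μ hμ => ?_⟩
  obtain ⟨t, ht⟩ := ConformalSphere.lengthFactor_const_of_le_lambdaBar hn μ
    (by rw [← hμ, hsup, hone])
  obtain ⟨x₀⟩ : Nonempty (ConformalSphere.Sph n) :=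
    (NormedSpace.sphere_nonempty.2 zero_le_one).to_subtype
  refine ⟨t, ?_, fun x v w => ?_⟩
  · rw [← ht x₀]
    exact mul_pos (ConformalSphere.lengthFactor_pos μ x₀) (ConformalSphere.lengthFactor_pos μ x₀)
  · rw [← ht x, ContinuousMap.mul_apply, ConformalSphere.lengthFactor_mul_self]
    rfl
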